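/- Let $C$ be an algebraically closed field of characteristic $0$ and, for every $m\ge 1$, let $\zeta_m\in C$ be a primitive $m$-th root of unity (for $C\subset\mathbb{C}$ one may take $\zeta_m=e^{2i\pi/m}$). Let $n$ be a prime number and let $G\subset \mathrm{GL}_n(C)$ be a Zariski closed subgroup with identity component $G^0$. Assume that $G$ is irreducible (no subspace of $C^n$ other than $0$ and $C^n$ is $G$-stable), that $G$ is imprimitive ($C^n=V_1\oplus\dots\oplus V_r$ with $r\ge 2$, all $V_i\neq 0$, and every element of $G$ permutes the $V_i$), and that $G/G^0$ is finite and cyclic. For $\alpha=(\alpha_1,\dots,\alpha_n)\in (C^*)^n$ put $\Pi\alpha=\prod_{i=1}^n\alpha_i$, let $E$ be the permutation matrix with entries $1$ at the positions $(1,2),(2,3),\dots,(n-1,n),(n,1)$, and for $\ell\ge 0$ let $\mathcal{M}_\ell=\{\mathrm{Diag}(\alpha)E^\ell \mid \alpha\in(C^*)^n\}$. Say that a group $H\subset \mathrm{GL}_n(C)$ is of type (1) if $H=\bigcup_{\ell=0}^{n-1}\mathcal{M}_\ell$, and of type (2) with parameters $(s,k,\alpha)$, where $s$ is a positive integer, $k$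 an integer and $\alpha\in(C^*)^n$, if $$H\cap\mathcal{M}_0=\{\mathrm{Diag}(\beta)\mid (\Pi\beta)^s=1\},\qquad \Pi\alpha=\zeta_{ns}^{\,k},\qquad \gcd(k,s)=1,$$ and $\mathrm{Diag}(\alpha)E$ belongs to $H$ and its class generates $H/H^0$. Below, isomorphisms $G^0\cong (C^*)^m$ and $H^0\cong (C^*)^m$ are isomorphisms of algebraic groups. Then: (A) Some conjugate $PGP^{-1}$, $P\in\mathrm{GL}_n(C)$, is of type (1), or of type (2) for some parameters $(s,k,\alpha)$. (B) If a conjugate $H=PGP^{-1}$ is of type (1), then $H^0\cong(C^*)^n$, $H/H^0\cong\mathbb{Z}/n\mathbb{Z}$ and $\det(H)=C^*$. (C) If a conjugate $H=PGP^{-1}$ is of type (2) with parameters $(s,k,\alpha)$, then $H^0=\{\mathrm{Diag}(\beta)\mid \Pi\beta=1\}\cong(C^*)^{n-1}$ and $H/H^0\cong\mathbb{Z}/ns\mathbb{Z}$; moreover $\det(H)\cong\mathbb{Z}/\bigl(2s/\gcd(k+s,2)\bigr)\mathbb{Z}$ if $n=2$, and $\det(H)\cong\mathbb{Z}/\bigl(ns/\gcd(k,n)\bigr)\mathbb{Z}$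 if $n>2$. (D) $\det(G)=C^*$ if and only if some conjugate of $G$ is of type (1). If $\det(G)\cong\mathbb{Z}/\nu\mathbb{Z}$ with $\nu\geq 1$, and a conjugate of $G$ is of type (2) with parameters $(s,k,\alpha)$, then $s=\nu/n$ if $n\mid\nu$, and $s=\nu$ otherwise. (E) Consequently, if $\det(G)=C^*$, then $G^0\cong(C^*)^n$ and $G/G^0\cong\mathbb{Z}/n\mathbb{Z}$. If $\det(G)\cong\mathbb{Z}/\nu\mathbb{Z}$ with $\nu\ge1$, then $G^0\cong(C^*)^{n-1}$ and $G/G^0\cong\mathbb{Z}/ns\mathbb{Z}$, where $s=\nu/n$ if $n\mid\nu$ and $s=\nu$ otherwise. -/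

import Mathlib

open scoped Matrix MatrixGroups Topology

section ZariskiTopology

variable {n : ℕ} {C : Type*} [Field C]

/-- The value at `g ∈ GL_n(C)` of a polynomial in the `n²` matrix entries. -/
noncomputable def evalEntries (p : MvPolynomial (Fin n × Fin n) C) (g : GL (Fin n) C) : C :=
  MvPolynomial.eval (fun ij => (g : Matrix (Fin n) (Fin n) C) ij.1 ij.2) p

/-- The common zeros in `GL_n(C)` of a set of polynomials in the matrix entries. -/
def zeroLocusGL (S : Set (MvPolynomial (Fin n × Fin n) C)) : Set (GL (Fin n) C) :=
  {g | ∀ p ∈ S, evalEntries p g = 0}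

variable (n C) in
/-- The Zariski topology on `GL_n(C)`: the closed sets are the zero loci of sets of polynomials. -/
@[reducible] def zariskiGL : TopologicalSpace (GL (Fin n) C) :=
  TopologicalSpace.ofClosed (Set.range zeroLocusGL)
    ⟨{1}, by
      ext g
      simp [zeroLocusGL, evalEntries]⟩
    (by
      intro A hA
      refine ⟨{p | ∃ S, zeroLocusGL S ∈ A ∧ p ∈ S}, ?_⟩
      ext g
      simp only [zeroLocusGL, Set.mem_ofPred_eq, Set.mem_sInter]
      constructor
      · intro h t ht
        obtain ⟨S, rfl⟩ := hA ht
        exact fun p hp => h p ⟨S, ht, hp⟩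
      · rintro h p ⟨S, hS, hp⟩
        exact h _ hS p hp)
    (by
      rintro _ ⟨S, rfl⟩ _ ⟨T, rfl⟩
      refine ⟨{r | ∃ p ∈ S, ∃ q ∈ T, r = p * q}, ?_⟩
      ext g
      simp only [zeroLocusGL, Set.mem_ofPred_eq, Set.mem_union]
      constructor
      · intro h
        by_contra! hc
        obtain ⟨⟨p, hp, hp0⟩, q, hq, hq0⟩ := hc
        have := h _ ⟨p, hp, q, hq, rfl⟩
        simp only [evalEntries, map_mul, mul_eq_zero] at this
        exact this.elim hp0 hq0
      · rintro (h | h) _ ⟨p, hp, q, hq, rfl⟩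
        · have := h p hp
          simp only [evalEntries] at this
          simp [evalEntries, this]
        · have := h q hq
          simp only [evalEntries] at this
          simp [evalEntries, this])

lemma isClosed_zariskiGL_iff (Z : Set (GL (Fin n) C)) :
    IsClosed[zariskiGL n C] Z ↔ ∃ S, zeroLocusGL S = Z := by
  rw [← @isOpen_compl_iff _ _ (zariskiGL n C)]
  change Zᶜᶜ ∈ Set.range zeroLocusGL ↔ _
  rw [compl_compl, Set.mem_range]

lemma continuous_zariskiGL_mul_mul (a b : GL (Fin n) C) :
    @Continuous _ _ (zariskiGL n C) (zariskiGL n C) (fun g => a * g * b) := by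
  let _ := zariskiGL n C
  rw [continuous_iff_isClosed]
  intro Z hZ
  obtain ⟨S, rfl⟩ := (isClosed_zariskiGL_iff Z).1 hZ
  let φ : Fin n × Fin n → MvPolynomial (Fin n × Fin n) C := fun ij =>
    ∑ l, (∑ k, MvPolynomial.C ((a : Matrix (Fin n) (Fin n) C) ij.1 k) * MvPolynomial.X (k, l)) *
      MvPolynomial.C ((b : Matrix (Fin n) (Fin n) C) l ij.2)
  refine (isClosed_zariskiGL_iff _).2 ⟨(MvPolynomial.bind₁ φ) '' S, ?_⟩
  have key : ∀ (p : MvPolynomial (Fin n × Fin n) C) (g : GL (Fin n) C),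
      evalEntries (MvPolynomial.bind₁ φ p) g = evalEntries p (a * g * b) := by
    intro p g
    simp only [evalEntries, MvPolynomial.eval, MvPolynomial.eval₂Hom_bind₁]
    congr 2
    funext ij
    simp [φ, Matrix.mul_apply]
  ext g
  simp only [zeroLocusGL, Set.mem_ofPred_eq, Set.mem_preimage, Set.forall_mem_image, key]

/-- A subgroup of `GL_n(C)` is algebraic when it is Zariski closed. -/
def IsAlgebraicSubgroup (G : Subgroup (GL (Fin n) C)) : Prop :=
  IsClosed[zariskiGL n C] (G : Set (GL (Fin n) C))

/-- The set `G⁰`: the connected component of `1` in `G` for the Zariski topology. -/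
def identityComponentSet (G : Subgroup (GL (Fin n) C)) : Set (GL (Fin n) C) :=
  @connectedComponentIn _ (zariskiGL n C) (G : Set (GL (Fin n) C)) 1

lemma identityComponentSet_subset (G : Subgroup (GL (Fin n) C)) :
    identityComponentSet G ⊆ G :=
  @connectedComponentIn_subset _ (zariskiGL n C) _ _

lemma one_mem_identityComponentSet (G : Subgroup (GL (Fin n) C)) :
    1 ∈ identityComponentSet G :=
  @mem_connectedComponentIn _ (zariskiGL n C) _ _ G.one_mem

lemma mul_mul_mem_identityComponentSet (G : Subgroup (GL (Fin n) C)) {a b x y : GL (Fin n) C}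
    (ha : a ∈ G) (hb : b ∈ G) (hx : x ∈ identityComponentSet G) (hxab : a * x * b = 1)
    (hy : y ∈ identityComponentSet G) : a * y * b ∈ identityComponentSet G := by
  let _ := zariskiGL n C
  have hpre : IsPreconnected ((fun g => a * g * b) '' identityComponentSet G) :=
    isPreconnected_connectedComponentIn.image _ (continuous_zariskiGL_mul_mul a b).continuousOn
  refine hpre.subset_connectedComponentIn (x := 1) ⟨x, hx, hxab⟩ ?_ ⟨y, hy, rfl⟩
  rintro _ ⟨z, hz, rfl⟩
  exact G.mul_mem (G.mul_mem ha (identityComponentSet_subset G hz)) hb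

/-- The identity component `G⁰`, as a subgroup of `GL_n(C)`. -/
def identityComponent (G : Subgroup (GL (Fin n) C)) : Subgroup (GL (Fin n) C) where
  carrier := identityComponentSet G
  one_mem' := one_mem_identityComponentSet G
  inv_mem' := by
    intro x hx
    have := mul_mul_mem_identityComponentSet G (G.inv_mem (identityComponentSet_subset G hx))
      G.one_mem hx (by simp) (one_mem_identityComponentSet G)
    simpa using this
  mul_mem' := by
    intro x y hx hy
    have hxi := mul_mul_mem_identityComponentSet G
      (G.inv_mem (identityComponentSet_subset G hx))
      G.one_mem hx (by simp) (one_mem_identityComponentSet G)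
    have := mul_mul_mem_identityComponentSet G (identityComponentSet_subset G hx)
      G.one_mem hxi (by simp) hy
    simpa using this

instance identityComponent_normal (G : Subgroup (GL (Fin n) C)) :
    ((identityComponent G).subgroupOf G).Normal where
  conj_mem := by
    rintro ⟨x, hxG⟩ hx ⟨g, hg⟩
    exact mul_mul_mem_identityComponentSet G hg (G.inv_mem hg) (one_mem_identityComponentSet G)
      (by simp) hx

/-- The component group `G / G⁰`. -/
abbrev ComponentGroup (G : Subgroup (GL (Fin n) C)) : Type _ :=
  G ⧸ (identityComponent G).subgroupOf G

end ZariskiTopology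

section AlgebraicIsomorphism

variable {n m : ℕ} {C : Type*} [Field C]

/-- A map from a subgroup of `GL_n(C)` to a subgroup of `GL_m(C)` is regular when every matrix
entry of the image is a polynomial in the entries and the inverse of the determinant. -/
def IsRegularHom {G : Subgroup (GL (Fin n) C)} {H : Subgroup (GL (Fin m) C)} (f : G → H) : Prop :=
  ∀ i j : Fin m, ∃ p : MvPolynomial (Option (Fin n × Fin n)) C, ∀ g : G,
    ((f g : GL (Fin m) C) : Matrix (Fin m) (Fin m) C) i j =
      MvPolynomial.eval (fun o => o.elim ((g : GL (Fin n) C) : Matrix (Fin n) (Fin n) C).det⁻¹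
        (fun ij => ((g : GL (Fin n) C) : Matrix (Fin n) (Fin n) C) ij.1 ij.2)) p

/-- Two linear groups are isomorphic as algebraic groups. -/
def AlgGroupIso (G : Subgroup (GL (Fin n) C)) (H : Subgroup (GL (Fin m) C)) : Prop :=
  ∃ f : G ≃* H, IsRegularHom f ∧ IsRegularHom f.symm

variable (m C) in
/-- The torus `(C^*)^m`, embedded in `GL_m(C)` as the group of diagonal matrices. -/
def torus : Subgroup (GL (Fin m) C) :=
  ((Units.map (Matrix.diagonalRingHom (Fin m) C : (Fin m → C) →* Matrix (Fin m) (Fin m) C)).comp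
    (MulEquiv.piUnits.symm : (Fin m → Cˣ) ≃* (Fin m → C)ˣ).toMonoidHom).range

end AlgebraicIsomorphism

section LinearGroups

variable {n : ℕ} {C : Type*} [Field C]

/-- `G` is irreducible: only the trivial subspaces of `C^n` are stable under `G`. -/
def IsIrreducibleGroup (G : Subgroup (GL (Fin n) C)) : Prop :=
  ∀ W : Submodule C (Fin n → C),
    (∀ g ∈ G, W.map (g : Matrix (Fin n) (Fin n) C).mulVecLin ≤ W) → W = ⊥ ∨ W = ⊤

/-- `G` is imprimitive: there is a decomposition of `C^n` into a direct sum of at least two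
nonzero subspaces that are permuted by every element of `G`. -/
def IsImprimitiveGroup (G : Subgroup (GL (Fin n) C)) : Prop :=
  ∃ (r : ℕ) (V : Fin r → Submodule C (Fin n → C)), 2 ≤ r ∧ (∀ i, V i ≠ ⊥) ∧
    DirectSum.IsInternal V ∧
    ∀ g ∈ G, ∃ σ : Equiv.Perm (Fin r), ∀ i,
      (V i).map (g : Matrix (Fin n) (Fin n) C).mulVecLin = V (σ i)

/-- The conjugate `P G P⁻¹`. -/
def conjSubgroup (P : GL (Fin n) C) (G : Subgroup (GL (Fin n) C)) : Subgroup (GL (Fin n) C) :=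
  G.map (MulAut.conj P).toMonoidHom

/-- The group `det(G)`. -/
def detGroup (G : Subgroup (GL (Fin n) C)) : Subgroup Cˣ :=
  G.map Matrix.GeneralLinearGroup.det

/-- The diagonal matrix `Diag(α₁, …, α_n)`. -/
def Diag (α : Fin n → Cˣ) : Matrix (Fin n) (Fin n) C :=
  Matrix.diagonal fun i => (α i : C)

variable (n C) in
/-- The cyclic permutation matrix with ones in the positions `(i, i + 1)` and `(n, 1)`. -/
def cycleMatrix : Matrix (Fin n) (Fin n) C :=
  Matrix.of fun i j => if j = finRotate n i then 1 else 0

variable (n C) in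
/-- The set `M_ℓ` of the matrices `Diag(α) E^ℓ`, where `E` is the cyclic permutation matrix. -/
def monomialSet (l : ℕ) : Set (GL (Fin n) C) :=
  {g | ∃ α : Fin n → Cˣ, (g : Matrix (Fin n) (Fin n) C) = Diag α * cycleMatrix n C ^ l}

variable (n C) in
/-- The diagonal matrices `Diag(α)` with `(α₁ ⋯ α_n)^s = 1`. -/
def diagProdPow (s : ℕ) : Set (GL (Fin n) C) :=
  {g | ∃ α : Fin n → Cˣ, (g : Matrix (Fin n) (Fin n) C) = Diag α ∧ (∏ i, α i) ^ s = 1}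

/-- `H` is the full group of monomial matrices over the cyclic permutations. -/
def IsFullMonomial (H : Subgroup (GL (Fin n) C)) : Prop :=
  (H : Set (GL (Fin n) C)) = ⋃ l ∈ Finset.range n, monomialSet n C l

/-- `H` is of the second type with parameters `s`, `k`, `α`, relative to a choice `ζ` of roots of
unity: the diagonal part of `H` is given by `(α₁ ⋯ α_n)^s = 1`, and `H / H⁰` is generated by
`Diag(α) E` where `α₁ ⋯ α_n = ζ_{ns}^k` and `gcd(k, s) = 1`. -/
def IsTwistedMonomial (ζ : ℕ → Cˣ) (H : Subgroup (GL (Fin n) C)) (s : ℕ) (k : ℤ)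
    (α : Fin n → Cˣ) : Prop :=
  0 < s ∧ (H : Set (GL (Fin n) C)) ∩ monomialSet n C 0 = diagProdPow n C s ∧
    ∏ i, α i = ζ (n * s) ^ k ∧ Int.gcd k s = 1 ∧
    ∃ M : H, ((M : GL (Fin n) C) : Matrix (Fin n) (Fin n) C) = Diag α * cycleMatrix n C ∧
      Subgroup.zpowers (M : ComponentGroup H) = ⊤

end LinearGroups

@[to_additive]
lemma prod_range_pow_apply {n : ℕ} {A : Type*} [CommMonoid A] {σ : Equiv.Perm (Fin n)}
    (hσ : σ.IsCycleOn Set.univ) (f : Fin n → A) (a : Fin n) :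
    ∏ k ∈ Finset.range n, f ((σ ^ k) a) = ∏ i, f i := by
  have hσ : σ.IsCycleOn ((Finset.univ : Finset (Fin n)) : Set (Fin n)) := by simpa using hσ
  refine Finset.prod_bij (fun k _ => (σ ^ k) a) (by simp) ?_ ?_ fun _ _ => rfl
  · intro k hk l hl h
    have := (hσ.pow_apply_eq_pow_apply (Finset.mem_univ a)).1 h
    rw [Finset.card_univ, Fintype.card_fin] at this
    exact Nat.ModEq.eq_of_lt_of_lt this (Finset.mem_range.1 hk) (Finset.mem_range.1 hl)
  · intro i _
    obtain ⟨k, hk, h⟩ := hσ.exists_pow_eq (Finset.mem_univ a) (Finset.mem_univ i)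
    exact ⟨k, by simpa using hk, h⟩

section Monomial

variable {n : ℕ} {C : Type*} [Field C]

/-- The monomial matrix whose only nonzero entry in row `i` is `α i`, in column `σ i`. -/
def monomialGL (σ : Equiv.Perm (Fin n)) (α : Fin n → Cˣ) : GL (Fin n) C where
  val := Matrix.of fun i j => if j = σ i then (α i : C) else 0
  inv := Matrix.of fun i j => if j = σ⁻¹ i then ((α (σ⁻¹ i))⁻¹ : Cˣ) else 0
  val_inv := by
    ext i j
    rw [Matrix.mul_apply, Finset.sum_eq_single (σ i) (by simp +contextual) (by simp)]
    simp [Matrix.one_apply, eq_comm]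
  inv_val := by
    ext i j
    rw [Matrix.mul_apply, Finset.sum_eq_single (σ⁻¹ i) (by simp +contextual) (by simp)]
    simp [Matrix.one_apply, eq_comm]

lemma monomialGL_apply (σ : Equiv.Perm (Fin n)) (α : Fin n → Cˣ) (i j : Fin n) :
    (monomialGL σ α : Matrix (Fin n) (Fin n) C) i j = if j = σ i then (α i : C) else 0 := rfl

lemma monomialGL_mul (σ τ : Equiv.Perm (Fin n)) (α β : Fin n → Cˣ) :
    monomialGL σ α * monomialGL τ β = monomialGL (τ * σ) (fun i => α i * β (σ i)) := by
  ext i j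
  rw [Units.val_mul, Matrix.mul_apply, Finset.sum_eq_single (σ i)
    (by simp +contextual [monomialGL_apply]) (by simp)]
  simp only [monomialGL_apply, Equiv.Perm.mul_apply]
  by_cases h : j = τ (σ i) <;> simp [h]

lemma monomialGL_one : monomialGL 1 (1 : Fin n → Cˣ) = 1 := by
  ext i j
  simp [monomialGL_apply, Matrix.one_apply, eq_comm]

lemma monomialGL_inv (σ : Equiv.Perm (Fin n)) (α : Fin n → Cˣ) :
    (monomialGL σ α)⁻¹ = monomialGL σ⁻¹ (fun i => (α (σ⁻¹ i))⁻¹) := by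
  rw [inv_eq_iff_mul_eq_one, monomialGL_mul, ← monomialGL_one]
  congr 1
  · simp
  · ext; simp

lemma monomialGL_inj {σ τ : Equiv.Perm (Fin n)} {α β : Fin n → Cˣ} :
    monomialGL σ α = monomialGL τ β ↔ σ = τ ∧ α = β := by
  refine ⟨fun h => ?_, by rintro ⟨rfl, rfl⟩; rfl⟩
  have h1 : ∀ i j, (if j = σ i then (α i : C) else 0) = if j = τ i then (β i : C) else 0 :=
    fun i j => by rw [← monomialGL_apply, h, monomialGL_apply]
  have h2 : σ = τ := by
    ext1 i
    by_contra hne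
    have := h1 i (σ i)
    simp [hne] at this
  subst h2
  refine ⟨rfl, ?_⟩
  ext i
  simpa using h1 i (σ i)

lemma monomialGL_pow (σ : Equiv.Perm (Fin n)) (α : Fin n → Cˣ) (j : ℕ) :
    monomialGL σ α ^ j = monomialGL (σ ^ j) (fun i => ∏ t ∈ Finset.range j, α ((σ ^ t) i)) := by
  induction j with
  | zero => simpa using (monomialGL_one (n := n) (C := C)).symm.trans (by rfl)
  | succ j ih =>
    rw [pow_succ, ih, monomialGL_mul, ← pow_succ']
    simp [Finset.prod_range_succ]

lemma monomialGL_zpow (σ : Equiv.Perm (Fin n)) (α : Fin n → Cˣ) (j : ℤ) :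
    ∃ β, monomialGL σ α ^ j = monomialGL (σ ^ j) β := by
  cases j with
  | ofNat j => exact ⟨_, by simpa using monomialGL_pow σ α j⟩
  | negSucc j =>
    rw [zpow_negSucc, zpow_negSucc, monomialGL_pow, monomialGL_inv]
    exact ⟨_, rfl⟩

lemma det_monomialGL (σ : Equiv.Perm (Fin n)) (α : Fin n → Cˣ) :
    Matrix.GeneralLinearGroup.det (monomialGL σ α) =
      Units.map (Int.castRingHom C).toMonoidHom (Equiv.Perm.sign σ) * ∏ i, α i := by
  ext
  have : (monomialGL σ α : Matrix (Fin n) (Fin n) C) =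
      Matrix.diagonal (fun i => (α i : C)) * σ.permMatrix C := by
    ext i j
    simp [monomialGL_apply, Matrix.diagonal_mul, PEquiv.toMatrix_apply, eq_comm]
  simp [this, Matrix.det_permutation, mul_comm]

lemma Diag_mul_cycleMatrix_pow (α : Fin n → Cˣ) (l : ℕ) :
    Diag α * cycleMatrix n C ^ l = (monomialGL (finRotate n ^ l) α : Matrix (Fin n) (Fin n) C) := by
  have h1 : cycleMatrix n C = (monomialGL (finRotate n) (1 : Fin n → Cˣ) :) := by
    ext i j; simp [monomialGL_apply, cycleMatrix]
  have h2 : Diag α = (monomialGL 1 α : GL (Fin n) C) := by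
    ext i j; simp [monomialGL_apply, Diag, Matrix.diagonal_apply, eq_comm]
  rw [h1, h2, ← Units.val_pow_eq_pow_val, ← Units.val_mul, monomialGL_pow, monomialGL_mul]
  simp

lemma mem_monomialSet {l : ℕ} {g : GL (Fin n) C} :
    g ∈ monomialSet n C l ↔ ∃ α, g = monomialGL (finRotate n ^ l) α := by
  simp only [monomialSet, Set.mem_ofPred_eq, Diag_mul_cycleMatrix_pow, Units.val_inj]

/-- `Diag` as a homomorphism to `GL_n(C)`. -/
def diagHom : (Fin n → Cˣ) →* GL (Fin n) C where
  toFun := monomialGL 1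
  map_one' := monomialGL_one
  map_mul' α β := by rw [monomialGL_mul]; simp; rfl

lemma diagHom_apply (α : Fin n → Cˣ) : diagHom α = monomialGL 1 α := rfl

lemma diagHom_injective : Function.Injective (diagHom : (Fin n → Cˣ) → GL (Fin n) C) :=
  fun _ _ h => (monomialGL_inj.1 h).2

lemma torus_eq_range : torus n C = (diagHom : (Fin n → Cˣ) →* GL (Fin n) C).range := by
  unfold torus
  congr 1
  ext α i j
  simp [diagHom_apply, monomialGL_apply, Matrix.diagonal_apply, eq_comm]

lemma mem_torus {g : GL (Fin n) C} : g ∈ torus n C ↔ ∃ α, g = monomialGL 1 α := by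
  simp [torus_eq_range, MonoidHom.mem_range, diagHom_apply, eq_comm]

/-- The product of the diagonal entries. -/
def prodHom : (Fin n → Cˣ) →* Cˣ where
  toFun α := ∏ i, α i
  map_one' := by simp
  map_mul' α β := Finset.prod_mul_distrib

variable (n C) in
/-- The group of diagonal matrices `Diag(α)` with `(α₁ ⋯ α_n)^s = 1`. -/
def diagProdPowSubgroup (s : ℕ) : Subgroup (GL (Fin n) C) :=
  ((powMonoidHom s).comp prodHom).ker.map (diagHom : (Fin n → Cˣ) →* GL (Fin n) C)

lemma mem_diagProdPowSubgroup {s : ℕ} {g : GL (Fin n) C} :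
    g ∈ diagProdPowSubgroup n C s ↔ ∃ α, g = monomialGL 1 α ∧ (∏ i, α i) ^ s = 1 := by
  simp only [diagProdPowSubgroup, Subgroup.mem_map, MonoidHom.mem_ker, diagHom_apply]
  exact exists_congr fun α => by rw [and_comm, eq_comm]; rfl

lemma monomialGL_mem_diagProdPowSubgroup {s : ℕ} {σ : Equiv.Perm (Fin n)} {α : Fin n → Cˣ} :
    monomialGL σ α ∈ diagProdPowSubgroup n C s ↔ σ = 1 ∧ (∏ i, α i) ^ s = 1 := by
  rw [mem_diagProdPowSubgroup]
  constructor
  · rintro ⟨β, h, hβ⟩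
    obtain ⟨rfl, rfl⟩ := monomialGL_inj.1 h
    exact ⟨rfl, hβ⟩
  · rintro ⟨rfl, h⟩
    exact ⟨α, rfl, h⟩

lemma coe_diagProdPowSubgroup (s : ℕ) :
    (diagProdPowSubgroup n C s : Set (GL (Fin n) C)) = diagProdPow n C s := by
  ext g
  have := fun α : Fin n → Cˣ => Diag_mul_cycleMatrix_pow α 0
  simp only [pow_zero, mul_one] at this
  simp only [SetLike.mem_coe, mem_diagProdPowSubgroup, diagProdPow, Set.mem_ofPred_eq, this,
    Units.val_inj]

lemma diagProdPowSubgroup_zero : diagProdPowSubgroup n C 0 = torus n C := by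
  ext g
  simp [mem_diagProdPowSubgroup, mem_torus]

lemma diagProdPowSubgroup_le_torus (s : ℕ) : diagProdPowSubgroup n C s ≤ torus n C := by
  intro g hg
  obtain ⟨α, rfl, -⟩ := mem_diagProdPowSubgroup.1 hg
  exact mem_torus.2 ⟨α, rfl⟩

end Monomial

section Topology

variable {n : ℕ} {C : Type*} [Field C]

lemma isClosed_setOf_evalEntries_eq_zero (p : MvPolynomial (Fin n × Fin n) C) :
    IsClosed[zariskiGL n C] {g | evalEntries p g = 0} :=
  (isClosed_zariskiGL_iff _).2 ⟨{p}, by simp [zeroLocusGL]⟩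

lemma mem_torus_iff_forall_ne {g : GL (Fin n) C} : g ∈ torus n C ↔
    ∀ i j, i ≠ j → (g : Matrix (Fin n) (Fin n) C) i j = 0 := by
  rw [mem_torus]
  constructor
  · rintro ⟨α, rfl⟩ i j hij
    simp [monomialGL_apply, hij.symm]
  · intro h
    have hg : (g : Matrix (Fin n) (Fin n) C) = Matrix.diagonal fun i => g i i := by
      ext i j
      by_cases hij : i = j
      · simp [hij]
      · simp [hij, h i j hij]
    have hne : ∀ i, (g : Matrix (Fin n) (Fin n) C) i i ≠ 0 := by
      have := (g.isUnit.map Matrix.detMonoidHom).ne_zero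
      rw [Matrix.coe_detMonoidHom, hg, Matrix.det_diagonal, Finset.prod_ne_zero_iff] at this
      exact fun i => this i (Finset.mem_univ i)
    refine ⟨fun i => Units.mk0 _ (hne i), ?_⟩
    ext i j
    by_cases hij : i = j
    · simp [hij, monomialGL_apply]
    · simp [monomialGL_apply, h i j hij, Ne.symm hij]

lemma isClosed_torus : IsClosed[zariskiGL n C] (torus n C : Set (GL (Fin n) C)) := by
  let _ := zariskiGL n C
  have : (torus n C : Set (GL (Fin n) C)) =
      ⋂ i, ⋂ j, ⋂ _ : i ≠ j, {g | evalEntries (MvPolynomial.X (i, j)) g = 0} := by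
    ext g
    simp only [SetLike.mem_coe, mem_torus_iff_forall_ne, Set.mem_iInter, Set.mem_ofPred_eq,
      evalEntries, MvPolynomial.eval_X]
  rw [this]
  exact isClosed_iInter fun i => isClosed_iInter fun j => isClosed_iInter fun _ =>
    isClosed_setOf_evalEntries_eq_zero _

lemma isClosed_diagProdPowSubgroup (s : ℕ) :
    IsClosed[zariskiGL n C] (diagProdPowSubgroup n C s : Set (GL (Fin n) C)) := by
  let _ := zariskiGL n C
  have : (diagProdPowSubgroup n C s : Set (GL (Fin n) C)) =
      (torus n C : Set (GL (Fin n) C)) ∩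
        {g | evalEntries ((∏ i, MvPolynomial.X (i, i)) ^ s - 1) g = 0} := by
    ext g
    simp only [SetLike.mem_coe, mem_torus, mem_diagProdPowSubgroup, Set.mem_inter_iff,
      Set.mem_ofPred_eq, evalEntries]
    rw [← exists_and_right]
    refine exists_congr fun α => and_congr_right ?_
    rintro rfl
    simp [monomialGL_apply, sub_eq_zero, Units.ext_iff]
  rw [this]
  exact isClosed_torus.inter (isClosed_setOf_evalEntries_eq_zero _)

variable (n C) in
/-- The group of scalar matrices. -/
def scalarSubgroup : Subgroup (GL (Fin n) C) :=
  (diagHom.comp (MonoidHom.pi fun _ : Fin n => MonoidHom.id Cˣ)).range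

lemma mem_scalarSubgroup {g : GL (Fin n) C} :
    g ∈ scalarSubgroup n C ↔ ∃ c : Cˣ, g = monomialGL 1 fun _ => c := by
  simp only [scalarSubgroup, MonoidHom.mem_range, eq_comm (a := g)]
  rfl

lemma isClosed_scalarSubgroup [NeZero n] :
    IsClosed[zariskiGL n C] (scalarSubgroup n C : Set (GL (Fin n) C)) := by
  let _ := zariskiGL n C
  have : (scalarSubgroup n C : Set (GL (Fin n) C)) = (torus n C : Set (GL (Fin n) C)) ∩
      ⋂ i, {g | evalEntries (MvPolynomial.X (i, i) - MvPolynomial.X (0, 0)) g = 0} := by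
    ext g
    simp only [SetLike.mem_coe, mem_torus, mem_scalarSubgroup, Set.mem_inter_iff,
      Set.mem_ofPred_eq, evalEntries, Set.mem_iInter]
    constructor
    · rintro ⟨c, rfl⟩
      exact ⟨⟨_, rfl⟩, fun i => by simp [monomialGL_apply]⟩
    · rintro ⟨⟨α, rfl⟩, h⟩
      refine ⟨α 0, ?_⟩
      congr 1
      ext i
      simpa [monomialGL_apply, sub_eq_zero] using h i
  rw [this]
  exact isClosed_torus.inter (isClosed_iInter fun i => isClosed_setOf_evalEntries_eq_zero _)

/-- A closed subgroup meeting `H` in a subgroup of finite index contains `H⁰`. -/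
lemma identityComponent_le_of_finiteIndex {H K : Subgroup (GL (Fin n) C)}
    (hK : IsAlgebraicSubgroup K) (hfin : (K.subgroupOf H).FiniteIndex) :
    identityComponent H ≤ K := by
  classical
  let _ := zariskiGL n C
  obtain ⟨S, hS⟩ : ∃ S : Finset H, ∀ h : H, ∃ x ∈ S, (x⁻¹ * h : H) ∈ K.subgroupOf H := by
    have : Finite (H ⧸ K.subgroupOf H) := inferInstance
    cases nonempty_fintype (H ⧸ K.subgroupOf H)
    refine ⟨Finset.univ.image (Quotient.out : H ⧸ K.subgroupOf H → H), fun h => ?_⟩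
    refine ⟨_, Finset.mem_image_of_mem _ (Finset.mem_univ (h : H ⧸ K.subgroupOf H)), ?_⟩
    rw [← QuotientGroup.eq]
    exact Quotient.out_eq _
  have hcos : ∀ x : GL (Fin n) C, IsClosed {g | x⁻¹ * g ∈ K} := fun x => by
    have := IsClosed.preimage (continuous_zariskiGL_mul_mul x⁻¹ 1) hK
    simpa [Set.preimage] using this
  have hZ : IsClosed (⋃ x ∈ S.filter (fun x : H => (x : GL (Fin n) C) ∉ K),
      {g : GL (Fin n) C | (x : GL (Fin n) C)⁻¹ * g ∈ K}) :=
    isClosed_biUnion_finset fun x _ => hcos x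
  have hpre : IsPreconnected (identityComponentSet H) := isPreconnected_connectedComponentIn
  intro g hg
  by_contra hgK
  have hgH : g ∈ H := identityComponentSet_subset H hg
  have := isPreconnected_closed_iff.1 hpre _ _ hK hZ ?_
    ⟨1, one_mem_identityComponentSet H, K.one_mem⟩ ?_
  · obtain ⟨y, -, hyK, hy⟩ := this
    simp only [Set.mem_iUnion, Finset.mem_filter, Set.mem_ofPred_eq] at hy
    obtain ⟨x, ⟨-, hx⟩, hxy⟩ := hy
    exact hx (by simpa using K.mul_mem hyK (K.inv_mem hxy))
  · intro y hy
    by_cases hyK : y ∈ K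
    · exact Or.inl hyK
    · right
      obtain ⟨x, hxS, hx⟩ := hS ⟨y, identityComponentSet_subset H hy⟩
      have hx' : (x : GL (Fin n) C)⁻¹ * y ∈ K := hx
      simp only [Set.mem_iUnion, Finset.mem_filter, Set.mem_ofPred_eq]
      exact ⟨x, ⟨hxS, fun hxK => hyK (by simpa using K.mul_mem hxK hx')⟩, hx'⟩
  · obtain ⟨x, hxS, hx⟩ := hS ⟨g, hgH⟩
    have hx' : (x : GL (Fin n) C)⁻¹ * g ∈ K := hx
    refine ⟨g, hg, ?_⟩
    simp only [Set.mem_iUnion, Finset.mem_filter, Set.mem_ofPred_eq]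
    exact ⟨x, ⟨hxS, fun hxK => hgK (by simpa using K.mul_mem hxK hx')⟩, hx'⟩

lemma finiteIndex_subgroupOf_of_finite {A X : Type*} [Group A] [Finite X] {H K : Subgroup A}
    (f : A → X) (hf : ∀ g ∈ H, ∀ h ∈ H, f g = f h → g⁻¹ * h ∈ K) :
    (K.subgroupOf H).FiniteIndex := by
  have : Finite (H ⧸ K.subgroupOf H) := by
    refine Finite.of_injective (fun q : H ⧸ K.subgroupOf H => f (Quotient.out q : H)) ?_
    intro p q hpq
    have := hf _ (Quotient.out p : H).2 _ (Quotient.out q : H).2 hpq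
    rw [← Quotient.out_eq p, ← Quotient.out_eq q]
    exact QuotientGroup.eq.2 this
  exact Subgroup.finiteIndex_of_finite_quotient

/-- A divisible subgroup of `H` lies in `H⁰` when the component group is finite. -/
lemma le_identityComponent_of_divisible {H K : Subgroup (GL (Fin n) C)}
    [Finite (ComponentGroup H)] (hKH : K ≤ H)
    (hK : ∀ N : ℕ, 0 < N → ∀ g ∈ K, ∃ h ∈ K, h ^ N = g) : K ≤ identityComponent H := by
  intro g hg
  obtain ⟨h, hh, rfl⟩ := hK (Nat.card (ComponentGroup H)) Nat.card_pos g hg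
  have : ((⟨h, hKH hh⟩ ^ Nat.card (ComponentGroup H) : H) : ComponentGroup H) = 1 := by
    rw [QuotientGroup.mk_pow, pow_card_eq_one']
  simpa [Subgroup.mem_subgroupOf] using (QuotientGroup.eq_one_iff _).1 this

end Topology

section Characters

variable {n : ℕ} {C : Type*} [Field C]

/-- The character of `(C^*)^n` with exponent vector `v`. -/
def torusCharacter (v : Fin n → ℤ) : (Fin n → Cˣ) →* Cˣ where
  toFun β := ∏ i, β i ^ v i
  map_one' := by simp
  map_mul' α β := by simp [mul_zpow, Finset.prod_mul_distrib]

lemma torusCharacter_apply (v : Fin n → ℤ) (β : Fin n → Cˣ) :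
    torusCharacter v β = ∏ i, β i ^ v i := rfl

lemma torusCharacter_add (v w : Fin n → ℤ) (β : Fin n → Cˣ) :
    torusCharacter (v + w) β = torusCharacter v β * torusCharacter w β := by
  simp [torusCharacter_apply, zpow_add, Finset.prod_mul_distrib]

lemma torusCharacter_neg (v : Fin n → ℤ) (β : Fin n → Cˣ) :
    torusCharacter (-v) β = (torusCharacter v β)⁻¹ := by
  simp [torusCharacter_apply]

lemma torusCharacter_const (c : ℤ) (β : Fin n → Cˣ) :
    torusCharacter (fun _ => c) β = (∏ i, β i) ^ c := by
  simp [torusCharacter_apply, Finset.prod_zpow]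

lemma torusCharacter_comp (σ : Equiv.Perm (Fin n)) (v : Fin n → ℤ) (β : Fin n → Cˣ) :
    torusCharacter (v ∘ σ) (β ∘ σ) = torusCharacter v β :=
  Equiv.prod_comp σ fun i => β i ^ v i

/-- A closed subgroup contains every diagonal matrix at which all characters that are trivial on
its diagonal part are trivial. -/
lemma monomialGL_one_mem_of_torusCharacter {H : Subgroup (GL (Fin n) C)}
    (hH : IsAlgebraicSubgroup H) {t : Fin n → Cˣ}
    (ht : ∀ v, (∀ β, monomialGL 1 β ∈ H → torusCharacter v β = 1) → torusCharacter v t = 1) :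
    monomialGL 1 t ∈ H := by
  classical
  obtain ⟨S, hS⟩ := (isClosed_zariskiGL_iff _).1 hH
  have hmem : ∀ g, g ∈ H ↔ ∀ p ∈ S, evalEntries p g = 0 := fun g => by
    rw [← SetLike.mem_coe, ← hS]; rfl
  rw [hmem]
  intro p hp
  let q : MvPolynomial (Fin n) C :=
    MvPolynomial.bind₁ (fun ij => if ij.2 = ij.1 then MvPolynomial.X ij.1 else 0) p
  have hq : ∀ β : Fin n → Cˣ, evalEntries p (monomialGL 1 β) =
      ∑ m ∈ q.support, q.coeff m * (torusCharacter (fun i => (m i : ℤ)) β : Cˣ) := by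
    intro β
    have : evalEntries p (monomialGL 1 β) = MvPolynomial.eval (fun i => (β i : C)) q := by
      simp only [q, evalEntries, MvPolynomial.eval, MvPolynomial.eval₂Hom_bind₁]
      congr 2
      funext ij
      by_cases h : ij.2 = ij.1 <;> simp [h, monomialGL_apply]
    rw [this, MvPolynomial.eval_eq']
    simp [torusCharacter_apply]
  rw [hq]
  let A : Subgroup (Fin n → Cˣ) := H.comap diagHom
  let χ : (Fin n →₀ ℕ) → (A →* C) := fun m =>
    (Units.coeHom C).comp ((torusCharacter fun i => (m i : ℤ)).comp A.subtype)
  have hχ : ∀ m m', χ m = χ m' → torusCharacter (fun i => (m i : ℤ)) t =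
      torusCharacter (fun i => (m' i : ℤ)) t := by
    intro m m' h
    have := ht ((fun i => (m i : ℤ)) + -fun i => (m' i : ℤ)) fun β hβ => by
      rw [torusCharacter_add, torusCharacter_neg, mul_inv_eq_one]
      exact Units.ext (DFunLike.congr_fun h (⟨β, hβ⟩ : A))
    rwa [torusCharacter_add, torusCharacter_neg, mul_inv_eq_one] at this
  have hzero := linearIndependent_iff'.1 (linearIndependent_monoidHom A C) (q.support.image χ)
    (fun f => ∑ m ∈ q.support with χ m = f, q.coeff m) (by
      funext β
      have h0 := (hmem _).1 β.2 p hp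
      rw [diagHom_apply, hq] at h0
      rw [Pi.zero_apply, ← h0, Finset.sum_apply,
        ← Finset.sum_fiberwise_of_maps_to (t := q.support.image χ) (g := χ)
          (fun m hm => Finset.mem_image_of_mem _ hm)]
      refine Finset.sum_congr rfl fun f _ => ?_
      rw [Pi.smul_apply, smul_eq_mul, Finset.sum_mul]
      refine Finset.sum_congr rfl fun m hm => ?_
      rw [← (Finset.mem_filter.1 hm).2]
      rfl)
  rw [← Finset.sum_fiberwise_of_maps_to (t := q.support.image χ) (g := χ)
    (fun m hm => Finset.mem_image_of_mem _ hm)]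
  refine Finset.sum_eq_zero fun f hf => ?_
  obtain ⟨m, hm, rfl⟩ := Finset.mem_image.1 hf
  rw [Finset.sum_congr rfl fun m' hm' => by rw [hχ m' m (Finset.mem_filter.1 hm').2],
    ← Finset.sum_mul, hzero _ hf, zero_mul]

end Characters

section Lattice

open Polynomial

/-- For `n` prime, a subgroup of `ℤ^n` stable under a transitive cyclic shift either consists of
constant vectors or contains a multiple of a difference of two basis vectors. -/
lemma exists_smul_single_sub_single_mem {n : ℕ} (hn : n.Prime) {σ : Equiv.Perm (Fin n)}
    (hσ : σ.IsCycleOn Set.univ) (L : AddSubgroup (Fin n → ℤ)) (hL : ∀ v ∈ L, v ∘ σ ∈ L)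
    {v : Fin n → ℤ} (hv : v ∈ L) {a b : Fin n} (hab : v a ≠ v b) :
    ∃ (N : ℤ) (i : Fin n), N ≠ 0 ∧
      N • (Pi.single (σ i) 1 - Pi.single i 1 : Fin n → ℤ) ∈ L := by
  have := Fact.mk hn
  have hnz : NeZero n := ⟨hn.ne_zero⟩
  let S : Module.End ℤ (Fin n → ℤ) := LinearMap.funLeft ℤ ℤ σ
  have hS : ∀ (k : ℕ) (w : Fin n → ℤ), (S ^ k) w = w ∘ (σ ^ k : Equiv.Perm (Fin n)) := by
    intro k
    induction k with
    | zero => intro w; rfl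
    | succ k ih => intro w; rw [pow_succ, Module.End.mul_apply, ih, pow_succ']; rfl
  let e : Fin n → ℤ := Pi.single 0 1
  have hcyc : σ.IsCycleOn ((Finset.univ : Finset (Fin n)) : Set (Fin n)) := by simpa using hσ
  have hinv : σ⁻¹.IsCycleOn ((Finset.univ : Finset (Fin n)) : Set (Fin n)) := by simpa using hσ
  have hSn : S ^ n = 1 := by
    refine LinearMap.ext fun w => ?_
    rw [hS]
    funext i
    have := hcyc.pow_card_apply (Finset.mem_univ i)
    simp only [Finset.card_univ, Fintype.card_fin] at this
    simp [this]
  have hSe : ∀ k : ℕ, (S ^ k) e = Pi.single (((σ⁻¹ : Equiv.Perm (Fin n)) ^ k) 0) 1 := by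
    intro k
    rw [hS]
    funext i
    simp only [e, Function.comp, Pi.single_apply, inv_pow, Equiv.Perm.eq_inv_iff_eq]
  have hbij : ∀ f : Fin n → (Fin n → ℤ),
      ∑ k ∈ Finset.range n, f (((σ⁻¹ : Equiv.Perm (Fin n)) ^ k) 0) = ∑ i, f i :=
    fun f => sum_range_nsmul_apply (Equiv.Perm.isCycleOn_inv.2 hσ) f 0
  let p : ℤ[X] := ∑ k ∈ Finset.range n, C (v (((σ⁻¹ : Equiv.Perm (Fin n)) ^ k) 0)) * X ^ k
  have hpv : aeval S p e = v := by
    simp only [p, map_sum, map_mul, aeval_C, aeval_X, map_pow, LinearMap.sum_apply,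
      Module.End.mul_apply, hSe]
    have := hbij fun i => v i • (Pi.single i 1 : Fin n → ℤ)
    simp only [Module.algebraMap_end_apply]
    rw [this]
    exact (pi_eq_sum_univ' v).symm
  have hcoeff : ∀ k < n, p.coeff k = v (((σ⁻¹ : Equiv.Perm (Fin n)) ^ k) 0) := by
    intro k hk
    simp [p, finsetSum_coeff, coeff_X_pow, hk]
  have hdeg : p.natDegree < n := by
    refine (natDegree_sum_le_of_forall_le (n := n - 1) _ _ fun k hk => ?_).trans_lt
      (Nat.sub_lt hn.pos one_pos)
    exact (natDegree_C_mul_X_pow_le _ _).trans (Nat.le_sub_one_of_lt (Finset.mem_range.1 hk))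
  have hnd : ¬ cyclotomic n ℚ ∣ p.map (Int.castRingHom ℚ) := by
    rintro ⟨q, hq⟩
    have hqd : q.natDegree = 0 := by
      by_cases hq0 : q = 0
      · simp [hq0]
      have h1 := congrArg natDegree hq
      rw [natDegree_mul (cyclotomic_ne_zero _ _) hq0, natDegree_cyclotomic,
        Nat.totient_prime hn, natDegree_map_eq_of_injective Int.cast_injective] at h1
      omega
    rw [eq_C_of_natDegree_eq_zero hqd] at hq
    have hconst : ∀ i, (v i : ℚ) = q.coeff 0 := by
      intro i
      obtain ⟨k, hk, rfl⟩ := hinv.exists_pow_eq (Finset.mem_univ 0) (Finset.mem_univ i)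
      rw [Finset.card_univ, Fintype.card_fin] at hk
      have h2 := congrArg (fun r => coeff r k) hq
      simpa [hcoeff k hk, cyclotomic_prime, finsetSum_coeff, coeff_X_pow, hk] using h2
    exact hab (by exact_mod_cast (hconst a).trans (hconst b).symm)
  obtain ⟨u, w, huw⟩ := ((cyclotomic.irreducible_rat hn.pos).coprime_iff_not_dvd.2 hnd).symm
  have hclear : ∀ r : ℚ[X], ∃ (c : ℤ) (R : ℤ[X]), c ≠ 0 ∧
      R.map (Int.castRingHom ℚ) = C (c : ℚ) * r := by
    intro r
    obtain ⟨c, hc, hc'⟩ := IsLocalization.integerNormalization_spec (nonZeroDivisors ℤ) r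
    refine ⟨c, IsLocalization.integerNormalization (nonZeroDivisors ℤ) r,
      nonZeroDivisors.ne_zero hc, ?_⟩
    rw [← algebraMap_int_eq, hc', ← Int.cast_smul_eq_zsmul ℚ, smul_eq_C_mul]
  obtain ⟨c, U, hc, hU⟩ := hclear u
  obtain ⟨d, W, hd, hW⟩ := hclear w
  have hpoly : C (c * d) * (X - 1) = C d * U * (X - 1) * p + C c * W * (X ^ n - 1) := by
    apply map_injective (Int.castRingHom ℚ) Int.cast_injective
    have := cyclotomic_prime_mul_X_sub_one ℚ n
    simp only [Polynomial.map_mul, Polynomial.map_add, Polynomial.map_sub, map_X,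
      Polynomial.map_one, Polynomial.map_pow, hU, hW, ← this, eq_intCast, Int.cast_mul,
      Polynomial.map_intCast, map_intCast]
    linear_combination (-(c : ℚ[X]) * (d : ℚ[X]) * (X - 1)) * huw
  have hstable : ∀ (r : ℤ[X]) (w : Fin n → ℤ), w ∈ L → aeval S r w ∈ L := by
    intro r w hw
    rw [aeval_eq_sum_range, LinearMap.sum_apply]
    refine L.sum_mem fun k hk => ?_
    clear hk
    rw [LinearMap.smul_apply]
    refine L.zsmul_mem ?_ _
    induction k with
    | zero => exact hw
    | succ k ih => rw [pow_succ', Module.End.mul_apply]; exact hL _ ih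
  have hfin := congrArg (fun r => aeval S r e) hpoly
  simp only [map_mul, map_add, map_sub, aeval_X, map_pow, map_one, hSn, sub_self, mul_zero,
    add_zero, Module.End.mul_apply, hpv, LinearMap.sub_apply, Module.End.one_apply, aeval_C,
    Module.algebraMap_end_apply] at hfin
  refine ⟨c * d, σ⁻¹ 0, mul_ne_zero hc hd, ?_⟩
  have hSe1 := hSe 1
  rw [pow_one, pow_one] at hSe1
  have hmem := hstable (C d * U * (X - 1)) v hv
  simp only [map_mul, map_sub, aeval_X, map_one, aeval_C, Module.End.mul_apply,
    Module.algebraMap_end_apply] at hmem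
  have hneg := L.neg_mem hmem
  rw [LinearMap.sub_apply, Module.End.one_apply, map_sub, smul_sub, ← hfin, hSe1] at hneg
  convert hneg using 1
  have h0 : σ (σ⁻¹ 0) = 0 := by simp
  simp only [e, h0, mul_smul, smul_sub, neg_sub]

end Lattice

section Classification

variable {n : ℕ} {C : Type*} [Field C]

/-- A closed subgroup `K` contains `H⁰` if the cosets of `K` in `H⁰` are separated by a function
with finitely many values. -/
lemma identityComponent_le_of_finite_image {H K : Subgroup (GL (Fin n) C)}
    [Finite (ComponentGroup H)] (hK : IsAlgebraicSubgroup K) {Y : Type*} (f : GL (Fin n) C → Y)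
    (hfin : (f '' (identityComponent H)).Finite)
    (hf : ∀ g ∈ identityComponent H, ∀ h ∈ identityComponent H, f g = f h → g⁻¹ * h ∈ K) :
    identityComponent H ≤ K := by
  refine identityComponent_le_of_finiteIndex hK ⟨?_⟩
  refine Subgroup.relIndex_ne_zero_trans (K := identityComponent H) ?_
    (Subgroup.finiteIndex_of_finite_quotient (H := (identityComponent H).subgroupOf H)).index_ne_zero
  have := hfin.to_subtype
  have h1 : (K.subgroupOf (identityComponent H)).FiniteIndex := by
    classical
    refine finiteIndex_subgroupOf_of_finite (X := Option (f '' (identityComponent H)))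
      (fun g => if hg : g ∈ identityComponent H then some ⟨f g, g, hg, rfl⟩ else none) ?_
    intro g hg h hh hgh
    simp only [hg, hh, dif_pos, Option.some.injEq] at hgh
    exact hf g hg h hh (congrArg Subtype.val hgh)
  exact h1.index_ne_zero

lemma finite_setOf_zpow_eq_one {N : ℤ} (hN : N ≠ 0) : {x : Cˣ | x ^ N = 1}.Finite := by
  have : {x : Cˣ | x ^ N = 1} ⊆ (rootsOfUnity N.natAbs C : Set Cˣ) := by
    intro x hx
    rw [SetLike.mem_coe, mem_rootsOfUnity]
    have hx : x ^ N = 1 := hx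
    obtain h | h := Int.natAbs_eq N <;> rw [h] at hx
    · exact_mod_cast hx
    · rw [zpow_neg, inv_eq_one] at hx
      exact_mod_cast hx
  have hNZ := NeZero.mk (Int.natAbs_ne_zero.2 hN)
  have : Finite (rootsOfUnity N.natAbs C : Set Cˣ) := inferInstanceAs (Finite (rootsOfUnity _ C))
  exact Set.Finite.subset (Set.toFinite _) ‹_›

/-- The diagonal entries of a diagonal matrix. -/
lemma exists_diagEntries : ∃ f : GL (Fin n) C → (Fin n → Cˣ), ∀ α, f (monomialGL 1 α) = α :=
  ⟨Function.invFun diagHom, fun α => Function.leftInverse_invFun diagHom_injective α⟩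

lemma monomialGL_conj (σ : Equiv.Perm (Fin n)) (α β : Fin n → Cˣ) :
    monomialGL σ α * monomialGL 1 β * (monomialGL σ α)⁻¹ = monomialGL 1 (β ∘ σ) := by
  rw [mul_inv_eq_iff_eq_mul, monomialGL_mul, monomialGL_mul]
  simp [mul_comm]

lemma isCycleOn_finRotate (hn : 2 ≤ n) : (finRotate n).IsCycleOn Set.univ := by
  have := (isCycle_finRotate_of_le hn).isCycleOn
  convert this
  ext i
  have : i ∈ (finRotate n).support := by simp [support_finRotate_of_le hn]
  simpa using this

/-- A monomial matrix commuting with every element of an irreducible group has trivial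
permutation. -/
lemma eq_one_of_commute_of_irreducible [IsAlgClosed C] [NeZero n] {H : Subgroup (GL (Fin n) C)}
    (hirr : IsIrreducibleGroup H) {σ : Equiv.Perm (Fin n)} {α : Fin n → Cˣ}
    (hcomm : ∀ h ∈ H, monomialGL σ α * h = h * monomialGL σ α) : σ = 1 := by
  let M := (monomialGL σ α : Matrix (Fin n) (Fin n) C)
  obtain ⟨μ, hμ⟩ := Module.End.exists_eigenvalue (M.mulVecLin)
  have htop : Module.End.eigenspace M.mulVecLin μ = ⊤ := by
    refine (hirr _ ?_).resolve_left hμ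
    rintro h hh _ ⟨v, hv, rfl⟩
    have hv : M.mulVecLin v = μ • v := Module.End.mem_eigenspace_iff.1 hv
    rw [Module.End.mem_eigenspace_iff]
    simp only [Matrix.mulVecLin_apply] at hv ⊢
    have hc : M * (h : Matrix (Fin n) (Fin n) C) = (h : Matrix (Fin n) (Fin n) C) * M := by
      simpa using congrArg Units.val (hcomm h hh)
    rw [Matrix.mulVec_mulVec, hc, ← Matrix.mulVec_mulVec, hv, Matrix.mulVec_smul]
  ext1 i
  by_contra hne
  have h1 : M.mulVecLin (Pi.single (σ i) 1) = μ • Pi.single (σ i) 1 :=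
    Module.End.mem_eigenspace_iff.1 (htop ▸ Submodule.mem_top)
  have h2 := congrFun h1 i
  rw [Matrix.mulVecLin_apply, Matrix.mulVec_single_one] at h2
  have hne : i ≠ σ i := Ne.symm hne
  simp [M, monomialGL_apply, hne] at h2

/-- The diagonal part of an irreducible closed group `H` with component group generated by
a cyclic monomial matrix. -/
lemma exists_diagonal_part_eq [IsAlgClosed C] (hn : n.Prime) {H : Subgroup (GL (Fin n) C)}
    (hH : IsAlgebraicSubgroup H) (hirr : IsIrreducibleGroup H) [Finite (ComponentGroup H)]
    (hle : identityComponent H ≤ torus n C) {α : Fin n → Cˣ}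
    (hM : monomialGL (finRotate n) α ∈ H)
    (hgen : ∀ h ∈ H, ∃ j : ℤ, ∃ d ∈ identityComponent H, h = monomialGL (finRotate n) α ^ j * d) :
    ∃ s : ℕ, H ⊓ torus n C = diagProdPowSubgroup n C s := by
  have hnz : NeZero n := ⟨hn.ne_zero⟩
  have hcyc := isCycleOn_finRotate hn.two_le
  have hA : ∀ β, monomialGL 1 β ∈ H → monomialGL 1 (β ∘ finRotate n) ∈ H := by
    intro β hβ
    rw [← monomialGL_conj _ α]
    exact H.mul_mem (H.mul_mem hM hβ) (H.inv_mem hM)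
  have hA' : ∀ β, monomialGL 1 β ∈ H → monomialGL 1 (β ∘ ((finRotate n)⁻¹ : Equiv.Perm (Fin n))) ∈ H := by
    intro β hβ
    have := monomialGL_inv (finRotate n) α
    rw [← monomialGL_conj _ (fun i => (α ((finRotate n)⁻¹ i))⁻¹), ← this]
    exact H.mul_mem (H.mul_mem (H.inv_mem hM) hβ) (H.inv_mem (H.inv_mem hM))
  let L : AddSubgroup (Fin n → ℤ) :=
    { carrier := {v | ∀ β, monomialGL 1 β ∈ H → torusCharacter v β = 1}
      zero_mem' := fun β _ => by simp [torusCharacter_apply]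
      add_mem' := fun {v w} hv hw β hβ => by
        rw [torusCharacter_add, hv β hβ, hw β hβ, mul_one]
      neg_mem' := fun {v} hv β hβ => by rw [torusCharacter_neg, hv β hβ, inv_one] }
  have hL : ∀ v ∈ L, v ∘ finRotate n ∈ L := by
    intro v hv β hβ
    have := hv _ (hA' β hβ)
    rw [← torusCharacter_comp (finRotate n)] at this
    simpa [Function.comp_assoc] using this
  by_cases hconst : ∀ v ∈ L, ∀ a b, v a = v b
  · obtain ⟨a, ha⟩ := Int.subgroup_cyclic (L.comap (Pi.constAddMonoidHom (Fin n) ℤ))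
    have hmem : ∀ c : ℤ, (fun _ => c) ∈ L ↔ (a.natAbs : ℤ) ∣ c := by
      intro c
      rw [Int.natAbs_dvd, ← Int.mem_zmultiples_iff, AddSubgroup.zmultiples_eq_closure, ← ha]
      rfl
    refine ⟨a.natAbs, le_antisymm ?_ ?_⟩
    · rintro _ ⟨hg, ht⟩
      obtain ⟨β, rfl⟩ := mem_torus.1 ht
      have := (hmem _).2 dvd_rfl β hg
      rw [torusCharacter_const] at this
      exact monomialGL_mem_diagProdPowSubgroup.2 ⟨rfl, by exact_mod_cast this⟩
    · intro g hg
      refine ⟨?_, diagProdPowSubgroup_le_torus _ hg⟩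
      obtain ⟨β, rfl, hβ⟩ := mem_diagProdPowSubgroup.1 hg
      refine monomialGL_one_mem_of_torusCharacter hH fun v hv => ?_
      obtain ⟨d, rfl⟩ : ∃ d, v = fun _ => d := ⟨v 0, funext fun i => hconst v hv i 0⟩
      obtain ⟨c, hc⟩ := (hmem _).1 hv
      rw [torusCharacter_const, hc, zpow_mul, zpow_natCast, hβ, one_zpow]
  · exfalso
    push Not at hconst
    obtain ⟨v, hv, a, b, hab⟩ := hconst
    obtain ⟨N, i₀, hN, hmem⟩ := exists_smul_single_sub_single_mem hn hcyc L hL hv hab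
    have hroot₀ : ∀ β, monomialGL 1 β ∈ H → (β (finRotate n i₀) / β i₀) ^ N = 1 := by
      intro β hβ
      have := hmem β hβ
      rw [torusCharacter_apply] at this
      rw [← this]
      simp only [Pi.smul_apply, Pi.sub_apply, smul_eq_mul, mul_sub, zpow_sub,
        Finset.prod_mul_distrib, Finset.prod_inv_distrib, div_eq_mul_inv, mul_zpow, inv_zpow]
      congr 1
      · rw [Finset.prod_eq_single (finRotate n i₀)] <;> simp +contextual
      · rw [Finset.prod_eq_single i₀] <;> simp +contextual
    have hroot : ∀ β, monomialGL 1 β ∈ H → ∀ i, (β (finRotate n i) / β i) ^ N = 1 := by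
      intro β hβ i
      obtain ⟨k, -, hk⟩ := Equiv.Perm.IsCycleOn.exists_pow_eq (s := Finset.univ) (f := finRotate n)
        (by simpa using hcyc) (Finset.mem_univ i₀) (Finset.mem_univ i)
      have hk' : ∀ k : ℕ, monomialGL 1 (β ∘ (finRotate n ^ k : Equiv.Perm (Fin n))) ∈ H := by
        intro k
        induction k with
        | zero => simpa using hβ
        | succ k ih => exact hA _ ih
      have := hroot₀ _ (hk' k)
      rw [Function.comp, ← Equiv.Perm.mul_apply, pow_mul_comm', Equiv.Perm.mul_apply, hk] at this
      rwa [Function.comp, hk] at this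
    obtain ⟨f, hf⟩ := exists_diagEntries (n := n) (C := C)
    have hscalar : identityComponent H ≤ scalarSubgroup n C := by
      refine identityComponent_le_of_finite_image isClosed_scalarSubgroup
        (fun g i => f g (finRotate n i) / f g i) ?_ ?_
      · refine Set.Finite.subset (Set.Finite.pi' fun _ => finite_setOf_zpow_eq_one (C := C) hN) ?_
        rintro _ ⟨g, hg, rfl⟩ i
        obtain ⟨β, rfl⟩ := mem_torus.1 (hle hg)
        simp only [hf]
        exact hroot β (identityComponentSet_subset H hg) i
      · intro g hg h hh hgh
        obtain ⟨β, rfl⟩ := mem_torus.1 (hle hg)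
        obtain ⟨γ, rfl⟩ := mem_torus.1 (hle hh)
        simp only [hf] at hgh
        rw [← diagHom_apply, ← diagHom_apply, ← map_inv, ← map_mul, diagHom_apply,
          mem_scalarSubgroup]
        refine ⟨(β 0)⁻¹ * γ 0, ?_⟩
        congr 1
        funext i
        obtain ⟨k, -, hk⟩ := Equiv.Perm.IsCycleOn.exists_pow_eq (s := Finset.univ) (f := finRotate n)
          (by simpa using hcyc) (Finset.mem_univ 0) (Finset.mem_univ i)
        subst hk
        induction k with
        | zero => rfl
        | succ k ih =>
          rw [← ih]
          have := congrFun hgh ((finRotate n ^ k) 0)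
          rw [pow_succ', Equiv.Perm.mul_apply]
          simp only [Pi.mul_apply, Pi.inv_apply]
          rw [inv_mul_eq_div, inv_mul_eq_div, div_eq_div_iff_div_eq_div]
          exact this.symm
    have hone : finRotate n = 1 := by
      refine eq_one_of_commute_of_irreducible hirr (α := α) fun h hh => ?_
      obtain ⟨j, d, hd, rfl⟩ := hgen h hh
      obtain ⟨c, rfl⟩ := mem_scalarSubgroup.1 (hscalar hd)
      have hc : Commute (monomialGL (finRotate n) α) (monomialGL 1 fun _ => c) := by
        rw [commute_iff_eq, monomialGL_mul, monomialGL_mul]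
        simp [mul_comm]
      exact ((Commute.refl _).zpow_right j).mul_right hc
    have := (isCycle_finRotate_of_le hn.two_le).ne_one
    exact this hone

end Classification

section CyclicGroups

lemma nonempty_mulEquiv_zmod_of_zpowers_eq_top {A : Type*} [Group A] {x : A} {m : ℕ}
    (hx : Subgroup.zpowers x = ⊤) (hm : orderOf x = m) :
    Nonempty (A ≃* Multiplicative (ZMod m)) := by
  subst hm
  rw [orderOf_eq_card_of_zpowers_eq_top hx]
  exact ⟨(zmodCyclicMulEquiv ⟨x, fun y => (Subgroup.eq_top_iff' _).1 hx y⟩).symm⟩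

lemma nonempty_zpowers_mulEquiv_zmod {A : Type*} [Group A] (x : A) :
    Nonempty (Subgroup.zpowers x ≃* Multiplicative (ZMod (orderOf x))) := by
  rw [← Nat.card_zpowers]
  exact ⟨(zmodCyclicMulEquiv inferInstance).symm⟩

lemma orderOf_eq_of_forall_zpow {A : Type*} [Group A] {x : A} {m : ℕ}
    (h : ∀ j : ℤ, x ^ j = 1 ↔ (m : ℤ) ∣ j) : orderOf x = m := by
  refine Nat.dvd_antisymm ?_ ?_
  · rw [orderOf_dvd_iff_pow_eq_one, ← zpow_natCast, h]
  · rw [← Int.natCast_dvd_natCast, ← h, zpow_natCast, pow_orderOf_eq_one]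

lemma IsPrimitiveRoot.orderOf_zpow {A : Type*} [CommGroup A] {x : A} {m : ℕ} (hm : 0 < m)
    (hx : IsPrimitiveRoot x m) (k : ℤ) : orderOf (x ^ k) = m / Int.gcd k m := by
  have h : orderOf (x ^ k) = orderOf (x ^ k.natAbs) := by
    obtain h | h := Int.natAbs_eq k <;> nth_rw 1 [h]
    · rw [zpow_natCast]
    · rw [zpow_neg, zpow_natCast, orderOf_inv]
  have hfin : IsOfFinOrder x := isOfFinOrder_iff_pow_eq_one.2 ⟨m, hm, hx.pow_eq_one⟩
  rw [h, hfin.orderOf_pow, ← hx.eq_orderOf, Int.gcd_eq_natAbs_gcd_natAbs, Int.natAbs_natCast,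
    Nat.gcd_comm]

lemma zpowers_mk_eq_top_iff {A : Type*} [Group A] {H N : Subgroup A} [(N.subgroupOf H).Normal]
    {M : A} (hM : M ∈ H) :
    Subgroup.zpowers ((⟨M, hM⟩ : H) : H ⧸ N.subgroupOf H) = ⊤ ↔
      ∀ h ∈ H, ∃ j : ℤ, ∃ d ∈ N, h = M ^ j * d := by
  rw [Subgroup.eq_top_iff']
  constructor
  · intro hz h hh
    obtain ⟨j, hj⟩ := Subgroup.mem_zpowers_iff.1 (hz ((⟨h, hh⟩ : H) : H ⧸ N.subgroupOf H))
    rw [← QuotientGroup.mk_zpow, QuotientGroup.eq, Subgroup.mem_subgroupOf] at hj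
    exact ⟨j, _, hj, by simp⟩
  · intro h q
    obtain ⟨⟨g, hg⟩, rfl⟩ := QuotientGroup.mk_surjective q
    obtain ⟨j, d, hd, rfl⟩ := h g hg
    refine Subgroup.mem_zpowers_iff.2 ⟨j, ?_⟩
    rw [← QuotientGroup.mk_zpow, QuotientGroup.eq, Subgroup.mem_subgroupOf]
    simpa using hd

end CyclicGroups

section Powers

variable {n : ℕ} {C : Type*} [Field C]

lemma monomialGL_finRotate_pow (hn : 2 ≤ n) (α : Fin n → Cˣ) :
    monomialGL (finRotate n) α ^ n = monomialGL 1 fun _ => ∏ i, α i := by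
  rw [monomialGL_pow]
  have hcyc := isCycleOn_finRotate hn
  congr 1
  · ext1 i
    have := Equiv.Perm.IsCycleOn.pow_card_apply (s := Finset.univ) (f := finRotate n)
      (by simpa using hcyc) (Finset.mem_univ i)
    simpa using this
  · funext i
    exact prod_range_pow_apply hcyc α i

lemma orderOf_finRotate (hn : 2 ≤ n) : orderOf (finRotate n) = n := by
  rw [(isCycle_finRotate_of_le hn).orderOf, support_finRotate_of_le hn, Finset.card_univ,
    Fintype.card_fin]

lemma monomialGL_finRotate_zpow_mem (hn : 2 ≤ n) (α : Fin n → Cˣ) (s : ℕ) (j : ℤ) :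
    monomialGL (finRotate n) α ^ j ∈ diagProdPowSubgroup n C s ↔
      (n : ℤ) ∣ j ∧ (∏ i, α i) ^ (j * s) = 1 := by
  by_cases hj : (n : ℤ) ∣ j
  · obtain ⟨i, rfl⟩ := hj
    have : monomialGL (finRotate n) α ^ (n * i : ℤ) =
        monomialGL 1 fun _ => (∏ i, α i) ^ i := by
      rw [zpow_mul, zpow_natCast, monomialGL_finRotate_pow hn, ← diagHom_apply, ← map_zpow]
      rfl
    simp only [this, monomialGL_mem_diagProdPowSubgroup, Finset.prod_const, Finset.card_univ,
      Fintype.card_fin, dvd_mul_right, true_and]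
    rw [← zpow_natCast, ← zpow_natCast, ← zpow_mul, ← zpow_mul,
      show i * (n * s) = n * i * (s : ℤ) by ring]
  · obtain ⟨β, hβ⟩ := monomialGL_zpow (finRotate n) α j
    simp only [hβ, monomialGL_mem_diagProdPowSubgroup, hj, false_and, iff_false, not_and]
    intro h
    rw [← orderOf_dvd_iff_zpow_eq_one, orderOf_finRotate hn] at h
    exact absurd h hj

lemma exists_pow_eq_and_prod_eq_one [IsAlgClosed C] [NeZero n] (β : Fin n → Cˣ) {N : ℕ}
    (hN : 0 < N) : ∃ γ : Fin n → Cˣ, γ ^ N = β ∧ (∏ i, β i = 1 → ∏ i, γ i = 1) := by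
  have hroot : ∀ b : Cˣ, ∃ c : Cˣ, c ^ N = b := fun b => by
    obtain ⟨z, hz⟩ := IsAlgClosed.exists_pow_nat_eq (b : C) hN
    have hz0 : z ≠ 0 := fun h => b.ne_zero (by rw [← hz, h, zero_pow hN.ne'])
    exact ⟨Units.mk0 z hz0, Units.ext (by simpa using hz)⟩
  choose f hf using hroot
  by_cases hβ : ∏ i, β i = 1
  · refine ⟨fun i => f (β i) * (Pi.mulSingle 0 (∏ i, f (β i))⁻¹ : Fin n → Cˣ) i, ?_, fun _ => ?_⟩
    · funext i
      rw [Pi.pow_apply, mul_pow, hf, mul_eq_left]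
      by_cases hi : i = 0
      · subst hi
        rw [Pi.mulSingle_eq_same, inv_pow, ← Finset.prod_pow, inv_eq_one]
        simpa [hf] using hβ
      · rw [Pi.mulSingle_eq_of_ne hi, one_pow]
    · rw [Finset.prod_mul_distrib, Finset.prod_pi_mulSingle']
      simp
  · exact ⟨fun i => f (β i), funext fun i => hf _, fun h => absurd h hβ⟩

lemma diagProdPowSubgroup_le_identityComponent [IsAlgClosed C] [NeZero n]
    {H : Subgroup (GL (Fin n) C)} [Finite (ComponentGroup H)] {s : ℕ} (hs : s ≤ 1)
    (hH : diagProdPowSubgroup n C s ≤ H) : diagProdPowSubgroup n C s ≤ identityComponent H := by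
  refine le_identityComponent_of_divisible hH fun N hN g hg => ?_
  obtain ⟨β, rfl, hβ⟩ := mem_diagProdPowSubgroup.1 hg
  obtain ⟨γ, rfl, hγ⟩ := exists_pow_eq_and_prod_eq_one β hN
  refine ⟨monomialGL 1 γ, monomialGL_mem_diagProdPowSubgroup.2 ⟨rfl, ?_⟩, ?_⟩
  · interval_cases s
    · simp
    · simpa using hγ (by simpa using hβ)
  · rw [← diagHom_apply, ← map_pow, diagHom_apply]

lemma identityComponent_eq_of_inf_torus_eq [IsAlgClosed C] [NeZero n]
    {H : Subgroup (GL (Fin n) C)} [Finite (ComponentGroup H)]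
    (hle : identityComponent H ≤ torus n C) {s : ℕ}
    (hs : H ⊓ torus n C = diagProdPowSubgroup n C s) :
    identityComponent H = diagProdPowSubgroup n C (min s 1) := by
  have hsub : diagProdPowSubgroup n C (min s 1) ≤ H := by
    refine le_trans ?_ (hs.symm.le.trans inf_le_left)
    intro g hg
    obtain ⟨β, rfl, hβ⟩ := mem_diagProdPowSubgroup.1 hg
    refine monomialGL_mem_diagProdPowSubgroup.2 ⟨rfl, ?_⟩
    obtain rfl | h := Nat.eq_zero_or_pos s
    · simp
    · rw [min_eq_right h, pow_one] at hβ
      rw [hβ, one_pow]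
  refine le_antisymm ?_ (diagProdPowSubgroup_le_identityComponent (min_le_right _ _) hsub)
  obtain rfl | h := Nat.eq_zero_or_pos s
  · simpa [diagProdPowSubgroup_zero] using hle
  have hle' : identityComponent H ≤ diagProdPowSubgroup n C s :=
    hs ▸ le_inf (identityComponentSet_subset H) hle
  rw [min_eq_right h]
  obtain ⟨f, hf⟩ := exists_diagEntries (n := n) (C := C)
  refine identityComponent_le_of_finite_image (isClosed_diagProdPowSubgroup 1)
    (fun g => ∏ i, f g i) ?_ ?_
  · refine (finite_setOf_zpow_eq_one (C := C) (N := s) (by omega)).subset ?_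
    rintro _ ⟨g, hg, rfl⟩
    obtain ⟨β, rfl, hβ⟩ := mem_diagProdPowSubgroup.1 (hle' hg)
    simpa [hf] using hβ
  · intro g hg h hh hgh
    obtain ⟨β, rfl, hβ⟩ := mem_diagProdPowSubgroup.1 (hle' hg)
    obtain ⟨γ, rfl, hγ⟩ := mem_diagProdPowSubgroup.1 (hle' hh)
    simp only [hf] at hgh
    rw [← diagHom_apply, ← diagHom_apply, ← map_inv, ← map_mul, diagHom_apply,
      monomialGL_mem_diagProdPowSubgroup]
    simp [Finset.prod_mul_distrib, hgh]

end Powers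

section Types

variable {n : ℕ} {C : Type*} [Field C]

lemma coe_inter_monomialSet_zero (H : Subgroup (GL (Fin n) C)) (s : ℕ) :
    (H : Set (GL (Fin n) C)) ∩ monomialSet n C 0 = diagProdPow n C s ↔
      H ⊓ torus n C = diagProdPowSubgroup n C s := by
  have : monomialSet n C 0 = torus n C := by
    ext g
    simp [mem_monomialSet, mem_torus]
  rw [this, ← coe_diagProdPowSubgroup, ← Subgroup.coe_inf, SetLike.coe_set_eq]

lemma isFullMonomial_of_torus_le (hn : 2 ≤ n) {H : Subgroup (GL (Fin n) C)}
    (hT : torus n C ≤ H) {α : Fin n → Cˣ} (hM : monomialGL (finRotate n) α ∈ H)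
    (hgen : ∀ h ∈ H, ∃ j : ℤ, ∃ d ∈ torus n C, h = monomialGL (finRotate n) α ^ j * d) :
    IsFullMonomial H := by
  ext g
  simp only [SetLike.mem_coe, Set.mem_iUnion, Finset.mem_range, mem_monomialSet]
  constructor
  · intro hg
    obtain ⟨j, d, hd, rfl⟩ := hgen g hg
    obtain ⟨β, rfl⟩ := mem_torus.1 hd
    obtain ⟨γ, hγ⟩ := monomialGL_zpow (finRotate n) α j
    refine ⟨(j % n).toNat, ?_, fun i => γ i * β ((finRotate n ^ j) i), ?_⟩
    · have := Int.emod_lt_of_pos j (by omega : (0 : ℤ) < n)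
      omega
    · rw [hγ, monomialGL_mul, one_mul]
      congr 1
      rw [← zpow_natCast, Int.toNat_of_nonneg (Int.emod_nonneg _ (by omega))]
      rw [← zpow_mod_orderOf, orderOf_finRotate hn]
  · rintro ⟨l, hl, β, rfl⟩
    have h := H.pow_mem hM l
    rw [monomialGL_pow] at h
    have h2 := H.mul_mem (hT (mem_torus.2 ⟨fun i => β i * (∏ t ∈ Finset.range l,
      α ((finRotate n ^ t) i))⁻¹, rfl⟩)) h
    rw [monomialGL_mul] at h2
    simpa using h2

lemma exists_isTwistedMonomial (hn : 2 ≤ n) {ζ : ℕ → Cˣ}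
    (hζ : ∀ m : ℕ, 0 < m → IsPrimitiveRoot (ζ m) m) {H : Subgroup (GL (Fin n) C)}
    {s : ℕ} (hs : 0 < s) (hD : H ⊓ torus n C = diagProdPowSubgroup n C s)
    (h0 : identityComponent H = diagProdPowSubgroup n C 1)
    {α : Fin n → Cˣ} (hM : monomialGL (finRotate n) α ∈ H)
    (hgen : ∀ h ∈ H, ∃ j : ℤ, ∃ d ∈ identityComponent H,
      h = monomialGL (finRotate n) α ^ j * d) :
    ∃ k, IsTwistedMonomial ζ H s k α := by
  have hnz : NeZero n := ⟨by omega⟩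
  have hns : 0 < n * s := by positivity
  have hnsz : NeZero (n * s) := ⟨hns.ne'⟩
  have hprim := hζ (n * s) hns
  have hroot : (∏ i, α i) ^ (n * s) = 1 := by
    have h1 : monomialGL (finRotate n) α ^ (n : ℤ) ∈ diagProdPowSubgroup n C s := by
      rw [← hD]
      refine Subgroup.mem_inf.2 ⟨H.zpow_mem hM _, ?_⟩
      rw [← diagProdPowSubgroup_zero, monomialGL_finRotate_zpow_mem hn]
      simp
    have := ((monomialGL_finRotate_zpow_mem hn α s _).1 h1).2
    exact_mod_cast this
  obtain ⟨k, hk⟩ : ∃ k : ℤ, ζ (n * s) ^ k = ∏ i, α i := by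
    rw [← Subgroup.mem_zpowers_iff, hprim.zpowers_eq, mem_rootsOfUnity, hroot]
  refine ⟨k, hs, (coe_inter_monomialSet_zero H s).2 hD, hk.symm, ?_, ⟨_, hM⟩, ?_,
    (zpowers_mk_eq_top_iff hM).2 hgen⟩
  · let β : Fin n → Cˣ := Pi.mulSingle 0 (ζ (n * s) ^ n)
    have hβprod : ∏ i, β i = ζ (n * s) ^ n := by simp [β, Finset.prod_pi_mulSingle']
    have hβ : monomialGL 1 β ∈ H := by
      refine (hD.symm.le.trans inf_le_left) (monomialGL_mem_diagProdPowSubgroup.2 ⟨rfl, ?_⟩)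
      rw [hβprod, ← pow_mul, hprim.pow_eq_one]
    obtain ⟨j, d, hd, hj⟩ := hgen _ hβ
    rw [h0] at hd
    have hj' : monomialGL (finRotate n) α ^ j = monomialGL 1 β * d⁻¹ := by
      rw [hj, mul_inv_cancel_right]
    have hmem : monomialGL (finRotate n) α ^ j ∈ torus n C := by
      rw [hj']
      exact mul_mem (mem_torus.2 ⟨β, rfl⟩)
        (inv_mem (diagProdPowSubgroup_le_torus _ hd))
    rw [← diagProdPowSubgroup_zero, monomialGL_finRotate_zpow_mem hn] at hmem
    obtain ⟨i, rfl⟩ := hmem.1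
    obtain ⟨γ, rfl, hγ⟩ := mem_diagProdPowSubgroup.1 hd
    rw [zpow_mul, zpow_natCast, monomialGL_finRotate_pow hn, ← diagHom_apply, ← diagHom_apply,
      ← diagHom_apply, ← map_zpow, ← map_mul] at hj
    have heq := diagHom_injective hj
    have hprod := congrArg (fun x : Fin n → Cˣ => ∏ i, x i) heq
    simp only [Pi.mul_apply, Pi.pow_apply, Finset.prod_mul_distrib, hβprod, Finset.prod_const,
      Finset.card_univ, Fintype.card_fin] at hprod
    rw [pow_one] at hγ
    rw [hγ, mul_one, ← hk, ← zpow_natCast, ← zpow_natCast, ← zpow_mul, ← zpow_mul,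
      ← div_eq_one, div_eq_mul_inv, ← zpow_sub, hprim.zpow_eq_one_iff_dvd] at hprod
    obtain ⟨c, hc⟩ := hprod
    have hc' : (1 : ℤ) - k * i = s * c := by
      have hn0 : (n : ℤ) ≠ 0 := by omega
      apply mul_left_cancel₀ hn0
      push_cast at hc
      linear_combination hc
    rw [← Int.isCoprime_iff_gcd_eq_one]
    exact ⟨i, c, by linear_combination -hc'⟩
  · have := Diag_mul_cycleMatrix_pow α 1
    rwa [pow_one, pow_one, eq_comm] at this

end Types

section Consequences

variable {n : ℕ} {C : Type*} [Field C]

lemma identityComponent_le_torus_of_monomial {H : Subgroup (GL (Fin n) C)}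
    [Finite (ComponentGroup H)] (hH : ∀ h ∈ H, ∃ σ α, h = monomialGL σ α) :
    identityComponent H ≤ torus n C := by
  classical
  have hperm : ∀ h : GL (Fin n) C, ∃ σ : Equiv.Perm (Fin n), h ∈ H → ∃ α, h = monomialGL σ α :=
    fun h => by
      by_cases hh : h ∈ H
      · obtain ⟨σ, α, rfl⟩ := hH h hh
        exact ⟨σ, fun _ => ⟨α, rfl⟩⟩
      · exact ⟨1, fun h => absurd h hh⟩
  choose f hf using hperm
  refine identityComponent_le_of_finite_image isClosed_torus f (Set.toFinite _) ?_
  intro g hg h hh hgh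
  obtain ⟨α, hα⟩ := hf g (identityComponentSet_subset H hg)
  obtain ⟨β, hβ⟩ := hf h (identityComponentSet_subset H hh)
  rw [hα, hβ, monomialGL_inv, monomialGL_mul, mem_torus, hgh]
  simp [monomialGL_inj]

lemma nonempty_componentGroup_mulEquiv (hn : 2 ≤ n) {H : Subgroup (GL (Fin n) C)} {s m : ℕ}
    (h0 : identityComponent H = diagProdPowSubgroup n C s) {α : Fin n → Cˣ}
    (hM : monomialGL (finRotate n) α ∈ H)
    (hgen : Subgroup.zpowers ((⟨_, hM⟩ : H) : ComponentGroup H) = ⊤)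
    (hm : ∀ j : ℤ, ((n : ℤ) ∣ j ∧ (∏ i, α i) ^ (j * s) = 1) ↔ (m : ℤ) ∣ j) :
    Nonempty (ComponentGroup H ≃* Multiplicative (ZMod m)) := by
  refine nonempty_mulEquiv_zmod_of_zpowers_eq_top hgen (orderOf_eq_of_forall_zpow fun j => ?_)
  rw [← hm, ← monomialGL_finRotate_zpow_mem hn, ← h0, ← QuotientGroup.mk_zpow,
    QuotientGroup.eq_one_iff]
  rfl

lemma IsFullMonomial.torus_le (hn : 2 ≤ n) {H : Subgroup (GL (Fin n) C)} (hH : IsFullMonomial H) :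
    torus n C ≤ H := by
  intro g hg
  rw [← SetLike.mem_coe, hH, Set.mem_iUnion₂]
  obtain ⟨α, rfl⟩ := mem_torus.1 hg
  exact ⟨0, Finset.mem_range.2 (by omega), mem_monomialSet.2 ⟨α, by simp⟩⟩

lemma IsFullMonomial.identityComponent_eq [IsAlgClosed C] (hn : 2 ≤ n)
    {H : Subgroup (GL (Fin n) C)} (hH : IsFullMonomial H) [Finite (ComponentGroup H)] :
    identityComponent H = torus n C := by
  have : NeZero n := ⟨by omega⟩
  have hle : identityComponent H ≤ torus n C := identityComponent_le_torus_of_monomial fun h hh => by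
    rw [← SetLike.mem_coe, hH, Set.mem_iUnion₂] at hh
    obtain ⟨l, -, hl⟩ := hh
    exact ⟨_, mem_monomialSet.1 hl⟩
  rw [← diagProdPowSubgroup_zero]
  refine identityComponent_eq_of_inf_torus_eq (s := 0) hle ?_
  rw [diagProdPowSubgroup_zero, inf_eq_right]
  exact hH.torus_le hn

lemma IsFullMonomial.nonempty_componentGroup_mulEquiv [IsAlgClosed C] (hn : 2 ≤ n)
    {H : Subgroup (GL (Fin n) C)} (hH : IsFullMonomial H) [Finite (ComponentGroup H)] :
    Nonempty (ComponentGroup H ≃* Multiplicative (ZMod n)) := by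
  have h0 := hH.identityComponent_eq hn
  have hM : monomialGL (finRotate n) 1 ∈ H := by
    rw [← SetLike.mem_coe, hH, Set.mem_iUnion₂]
    exact ⟨1, Finset.mem_range.2 (by omega), mem_monomialSet.2 ⟨1, by simp⟩⟩
  refine _root_.nonempty_componentGroup_mulEquiv hn (s := 0)
    (by rw [h0, diagProdPowSubgroup_zero]) hM ((zpowers_mk_eq_top_iff hM).2 fun h hh => ?_)
    (by simp)
  rw [← SetLike.mem_coe, hH, Set.mem_iUnion₂] at hh
  obtain ⟨l, -, hl⟩ := hh
  obtain ⟨α, rfl⟩ := mem_monomialSet.1 hl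
  refine ⟨l, monomialGL 1 fun i => α (((finRotate n ^ l)⁻¹ : Equiv.Perm (Fin n)) i), ?_, ?_⟩
  · rw [h0]
    exact mem_torus.2 ⟨_, rfl⟩
  · rw [zpow_natCast, monomialGL_pow, monomialGL_mul]
    simp

lemma IsFullMonomial.detGroup_eq_top (hn : 2 ≤ n) {H : Subgroup (GL (Fin n) C)}
    (hH : IsFullMonomial H) : detGroup H = ⊤ := by
  have : NeZero n := ⟨by omega⟩
  refine eq_top_iff.2 fun u _ => ?_
  refine ⟨monomialGL 1 (Pi.mulSingle 0 u), hH.torus_le hn (mem_torus.2 ⟨_, rfl⟩), ?_⟩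
  rw [det_monomialGL]
  simp [Finset.prod_pi_mulSingle']

lemma le_torus_of_commute_diagProdPowSubgroup [CharZero C] {K : Subgroup (GL (Fin n) C)}
    (hK : ∀ g ∈ K, ∀ d ∈ diagProdPowSubgroup n C 1, g * d = d * g) : K ≤ torus n C := by
  intro g hg
  rw [mem_torus_iff_forall_ne]
  intro i j hij
  let t : Cˣ := Units.mk0 2 two_ne_zero
  let β : Fin n → Cˣ := Pi.mulSingle i t * Pi.mulSingle j t⁻¹
  have hβ : monomialGL 1 β ∈ diagProdPowSubgroup n C 1 := by
    refine monomialGL_mem_diagProdPowSubgroup.2 ⟨rfl, ?_⟩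
    simp [β, Finset.prod_mul_distrib, Finset.prod_pi_mulSingle']
  have hβi : β i = t := by simp [β, hij]
  have hβj : β j = t⁻¹ := by simp [β, hij.symm]
  have h : ((g * monomialGL 1 β : GL (Fin n) C) : Matrix (Fin n) (Fin n) C) i j =
      ((monomialGL 1 β * g : GL (Fin n) C) : Matrix (Fin n) (Fin n) C) i j := by
    rw [hK g hg _ hβ]
  rw [Units.val_mul, Units.val_mul, Matrix.mul_apply, Matrix.mul_apply, Finset.sum_eq_single j
      (fun k _ hk => by simp [monomialGL_apply, Ne.symm hk]) (by simp),
    Finset.sum_eq_single i (fun k _ hk => by simp [monomialGL_apply, hk]) (by simp)] at h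
  simp only [monomialGL_apply, Equiv.Perm.one_apply, if_true, hβi, hβj, t, Units.val_inv_eq_inv_val,
    Units.val_mk0] at h
  have h3 : (3 : C) * (g : Matrix (Fin n) (Fin n) C) i j = 0 := by
    field_simp at h
    linear_combination -h
  simpa using h3

variable {ζ : ℕ → Cˣ} {H : Subgroup (GL (Fin n) C)} {s : ℕ} {k : ℤ} {α : Fin n → Cˣ}

lemma IsTwistedMonomial.exists_mem (h : IsTwistedMonomial ζ H s k α) :
    ∃ hM : monomialGL (finRotate n) α ∈ H,
      Subgroup.zpowers ((⟨_, hM⟩ : H) : ComponentGroup H) = ⊤ := by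
  obtain ⟨-, -, -, -, ⟨M, hM⟩, h1, h2⟩ := h
  have := Diag_mul_cycleMatrix_pow α 1
  rw [pow_one, pow_one] at this
  rw [this, Units.val_inj] at h1
  subst h1
  exact ⟨hM, h2⟩

lemma IsTwistedMonomial.identityComponent_eq [IsAlgClosed C] [CharZero C] (hn : 2 ≤ n)
    (h : IsTwistedMonomial ζ H s k α) [Finite (ComponentGroup H)]
    (hcomm : ∀ g ∈ identityComponent H, ∀ h ∈ identityComponent H, g * h = h * g) :
    identityComponent H = diagProdPowSubgroup n C 1 := by
  have : NeZero n := ⟨by omega⟩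
  obtain ⟨hs, hD, -⟩ := h
  rw [coe_inter_monomialSet_zero] at hD
  have h1 : diagProdPowSubgroup n C 1 ≤ H := by
    refine le_trans ?_ (hD.symm.le.trans inf_le_left)
    intro g hg
    obtain ⟨β, rfl, hβ⟩ := mem_diagProdPowSubgroup.1 hg
    rw [pow_one] at hβ
    exact monomialGL_mem_diagProdPowSubgroup.2 ⟨rfl, by rw [hβ, one_pow]⟩
  have h2 := diagProdPowSubgroup_le_identityComponent le_rfl h1
  have h3 := identityComponent_eq_of_inf_torus_eq
    (le_torus_of_commute_diagProdPowSubgroup fun g hg d hd => hcomm g hg d (h2 hd)) hD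
  rwa [min_eq_right hs] at h3

lemma IsTwistedMonomial.nonempty_componentGroup_mulEquiv (hn : 2 ≤ n)
    (hζ : ∀ m : ℕ, 0 < m → IsPrimitiveRoot (ζ m) m) (h : IsTwistedMonomial ζ H s k α)
    (h0 : identityComponent H = diagProdPowSubgroup n C 1) :
    Nonempty (ComponentGroup H ≃* Multiplicative (ZMod (n * s))) := by
  obtain ⟨hM, hgen⟩ := h.exists_mem
  obtain ⟨hs, -, hα, hk, -⟩ := h
  refine _root_.nonempty_componentGroup_mulEquiv hn h0 hM hgen fun j => ?_
  rw [hα, Nat.cast_one, mul_one, ← zpow_mul, (hζ (n * s) (by positivity)).zpow_eq_one_iff_dvd]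
  have hn0 : (n : ℤ) ≠ 0 := by omega
  constructor
  · rintro ⟨⟨i, rfl⟩, h2⟩
    rw [Nat.cast_mul, mul_left_comm, mul_dvd_mul_iff_left hn0] at h2
    rw [Nat.cast_mul, mul_dvd_mul_iff_left hn0]
    exact (Int.isCoprime_iff_gcd_eq_one.2 hk).symm.dvd_of_dvd_mul_left h2
  · intro h2
    refine ⟨dvd_trans ?_ h2, dvd_mul_of_dvd_right h2 _⟩
    simp

lemma IsTwistedMonomial.detGroup_eq_zpowers (h : IsTwistedMonomial ζ H s k α)
    (h0 : identityComponent H = diagProdPowSubgroup n C 1) :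
    detGroup H = Subgroup.zpowers
      (Units.map (Int.castRingHom C).toMonoidHom (Equiv.Perm.sign (finRotate n)) *
        ζ (n * s) ^ k) := by
  obtain ⟨hM, hgen⟩ := h.exists_mem
  rw [zpowers_mk_eq_top_iff hM] at hgen
  rw [← h.2.2.1, ← det_monomialGL]
  apply le_antisymm
  · rintro _ ⟨g, hg, rfl⟩
    obtain ⟨j, d, hd, rfl⟩ := hgen g hg
    rw [h0] at hd
    obtain ⟨β, rfl, hβ⟩ := mem_diagProdPowSubgroup.1 hd
    rw [pow_one] at hβ
    have : Matrix.GeneralLinearGroup.det (monomialGL 1 β) = 1 := by simp [det_monomialGL, hβ]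
    rw [map_mul, map_zpow, this, mul_one]
    exact Subgroup.zpow_mem_zpowers _ _
  · rw [Subgroup.zpowers_le]
    exact ⟨_, hM, rfl⟩

/-- The order of the determinant group in the second case. -/
lemma IsTwistedMonomial.nonempty_detGroup_mulEquiv (hn : n.Prime)
    (hζ : ∀ m : ℕ, 0 < m → IsPrimitiveRoot (ζ m) m) (h : IsTwistedMonomial ζ H s k α)
    (h0 : identityComponent H = diagProdPowSubgroup n C 1) :
    Nonempty (detGroup H ≃* Multiplicative (ZMod
      (if n = 2 then 2 * s / Int.gcd (k + s) 2 else n * s / Int.gcd k n))) := by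
  have hs := h.1
  have hk := h.2.2.2.1
  have hpos : 0 < n * s := Nat.mul_pos hn.pos hs
  have hprim := hζ (n * s) hpos
  have hgcd : ∀ l : ℤ, Int.gcd l s = 1 → Int.gcd l (n * s : ℕ) = Int.gcd l n := by
    intro l hl
    rw [Int.gcd_eq_natAbs_gcd_natAbs] at hl ⊢
    rw [Int.gcd_eq_natAbs_gcd_natAbs]
    simp only [Int.natAbs_natCast] at hl ⊢
    exact Nat.Coprime.gcd_mul_right_cancel_right n (Nat.Coprime.symm hl)
  rw [h.detGroup_eq_zpowers h0, sign_finRotate]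
  by_cases h2 : n = 2
  · subst h2
    have hneg : Units.map (Int.castRingHom C).toMonoidHom ((-1) ^ (2 - 1)) = ζ (2 * s) ^ s := by
      have h3 := IsPrimitiveRoot.coe_units_iff.2 (hprim.pow hpos (mul_comm 2 s))
      ext
      simp [h3.eq_neg_one_of_two_right]
    rw [if_pos rfl, hneg, ← zpow_natCast, ← zpow_add, add_comm]
    have := hprim.orderOf_zpow hpos (k + s)
    rw [hgcd _ (by simpa using hk)] at this
    exact this ▸ nonempty_zpowers_mulEquiv_zmod _
  · have hev : Even (n - 1) := hn.even_sub_one h2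
    rw [if_neg h2, hev.neg_one_pow, map_one, one_mul]
    have := hprim.orderOf_zpow hpos k
    rw [hgcd _ hk] at this
    exact this ▸ nonempty_zpowers_mulEquiv_zmod _

/-- The parameter `s` is determined by the order of the determinant group. -/
lemma eq_ite_dvd_of_order_eq (hn : n.Prime) (hs : 0 < s) (hk : Int.gcd k s = 1) {ν : ℕ}
    (hν : ν = if n = 2 then 2 * s / Int.gcd (k + s) 2 else n * s / Int.gcd k n) :
    s = if n ∣ ν then ν / n else ν := by
  obtain ⟨l, hl, hνl⟩ : ∃ l : ℤ, Int.gcd l s = 1 ∧ ν = n * s / Int.gcd l n := by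
    split_ifs at hν with h2
    · subst h2
      exact ⟨k + s, by simpa using hk, hν⟩
    · exact ⟨k, hk, hν⟩
  by_cases hnl : (n : ℤ) ∣ l
  · have hg : Int.gcd l n = n := by
      rw [Int.gcd_eq_natAbs_gcd_natAbs, Int.natAbs_natCast]
      exact Nat.gcd_eq_right (Int.natCast_dvd.1 hnl)
    rw [hg, Nat.mul_div_cancel_left _ hn.pos] at hνl
    subst hνl
    rw [if_neg]
    intro hns
    have : n ∣ Int.gcd l ν := Int.dvd_gcd hnl (Int.natCast_dvd_natCast.2 hns)
    rw [hl] at this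
    exact hn.one_lt.ne' (Nat.dvd_one.1 this)
  · have hg : Int.gcd l n = 1 := by
      have h1 : Int.gcd l n ∣ n := by
        exact_mod_cast Int.gcd_dvd_right l n
      refine (hn.eq_one_or_self_of_dvd _ h1).resolve_right fun h2 => hnl ?_
      rw [← h2]
      exact Int.gcd_dvd_left l n
    rw [hg, Nat.div_one] at hνl
    subst hνl
    rw [if_pos (dvd_mul_right _ _), Nat.mul_div_cancel_left _ hn.pos]

end Consequences

section AlgebraicIsomorphisms

variable {n m : ℕ} {C : Type*} [Field C]

lemma AlgGroupIso.refl (G : Subgroup (GL (Fin n) C)) : AlgGroupIso G G :=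
  ⟨MulEquiv.refl G, fun i j => ⟨MvPolynomial.X (some (i, j)), by simp⟩,
    fun i j => ⟨MvPolynomial.X (some (i, j)), by simp⟩⟩

lemma algGroupIso_diagProdPowSubgroup_one (m : ℕ) :
    AlgGroupIso (diagProdPowSubgroup (m + 1) C 1) (torus m C) := by
  let φ : (Fin m → Cˣ) →* GL (Fin (m + 1)) C :=
    { toFun := fun β => diagHom (Fin.snoc β (∏ i, β i)⁻¹ : Fin (m + 1) → Cˣ)
      map_one' := by
        rw [← map_one diagHom]
        congr 1
        ext i
        refine Fin.lastCases ?_ (fun i => ?_) i <;> simp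
      map_mul' := fun β γ => by
        rw [← map_mul]
        congr 1
        ext i
        refine Fin.lastCases ?_ (fun i => ?_) i <;> simp [Finset.prod_mul_distrib, mul_comm] }
  have hφ : ∀ β, φ β = monomialGL 1 (Fin.snoc β (∏ i, β i)⁻¹ : Fin (m + 1) → Cˣ) := fun _ => rfl
  have hφi : Function.Injective φ := fun β γ h => by
    have := diagHom_injective h
    funext i
    simpa using congrFun this i.castSucc
  have hφr : diagProdPowSubgroup (m + 1) C 1 = φ.range := by
    ext g
    rw [mem_diagProdPowSubgroup]
    constructor
    · rintro ⟨β, rfl, hβ⟩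
      refine ⟨fun i => β i.castSucc, ?_⟩
      rw [hφ]
      congr 1
      funext i
      refine Fin.lastCases ?_ (fun i => ?_) i
      · rw [pow_one, Fin.prod_univ_castSucc, mul_eq_one_iff_inv_eq] at hβ
        simpa using hβ
      · simp
    · rintro ⟨β, rfl⟩
      exact ⟨_, hφ β, by simp [Fin.prod_univ_castSucc]⟩
  rw [hφr, torus_eq_range]
  let e₁ := MonoidHom.ofInjective hφi
  let e₂ := MonoidHom.ofInjective (diagHom_injective (n := m) (C := C))
  refine ⟨e₁.symm.trans e₂, fun i j => ?_, fun i j => ?_⟩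
  · refine ⟨if i = j then MvPolynomial.X (some (i.castSucc, i.castSucc)) else 0, fun g => ?_⟩
    obtain ⟨β, rfl⟩ := e₁.surjective g
    have h1 : ((e₁ β : GL (Fin (m + 1)) C)) = monomialGL 1 (Fin.snoc β (∏ i, β i)⁻¹) := rfl
    have h2 : ((e₂ β : GL (Fin m) C)) = monomialGL 1 β := rfl
    simp only [MulEquiv.trans_apply, MulEquiv.symm_apply_apply, h1, h2]
    by_cases hij : i = j
    · simp [hij, monomialGL_apply]
    · simp [hij, monomialGL_apply, Ne.symm hij]
  · refine ⟨if i = j then Fin.lastCases (MvPolynomial.X none)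
      (fun i => MvPolynomial.X (some (i, i))) i else 0, fun g => ?_⟩
    obtain ⟨β, rfl⟩ := e₂.surjective g
    have h1 : ((e₁ β : GL (Fin (m + 1)) C)) = monomialGL 1 (Fin.snoc β (∏ i, β i)⁻¹) := rfl
    have h2 : ((e₂ β : GL (Fin m) C)) = monomialGL 1 β := rfl
    have h3 : (monomialGL 1 β : Matrix (Fin m) (Fin m) C).det = ∏ i, (β i : C) := by
      have := congrArg Units.val (det_monomialGL 1 β)
      simpa using this
    have h4 : (e₁.symm.trans e₂).symm (e₂ β) = e₁ β := by simp
    rw [h4, h1, h2]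
    by_cases hij : i = j
    · subst hij
      refine Fin.lastCases ?_ (fun i => ?_) i
      · simp [monomialGL_apply, h3]
      · simp [monomialGL_apply]
    · simp [hij, monomialGL_apply, Ne.symm hij]

end AlgebraicIsomorphisms

section Conjugation

variable {n m : ℕ} {C : Type*} [Field C]

/-- A subgroup is isomorphic to its conjugates. -/
noncomputable def conjEquiv (P : GL (Fin n) C) (G : Subgroup (GL (Fin n) C)) :
    G ≃* conjSubgroup P G :=
  G.equivMapOfInjective _ (MulAut.conj P).injective

lemma coe_conjEquiv (P : GL (Fin n) C) (G : Subgroup (GL (Fin n) C)) (g : G) :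
    (conjEquiv P G g : GL (Fin n) C) = P * g * P⁻¹ := rfl

lemma mem_conjSubgroup {P : GL (Fin n) C} {G : Subgroup (GL (Fin n) C)} {h : GL (Fin n) C} :
    h ∈ conjSubgroup P G ↔ ∃ g ∈ G, P * g * P⁻¹ = h := Iff.rfl

lemma conjSubgroup_conjSubgroup (P Q : GL (Fin n) C) (G : Subgroup (GL (Fin n) C)) :
    conjSubgroup P (conjSubgroup Q G) = conjSubgroup (P * Q) G := by
  ext h
  simp only [mem_conjSubgroup]
  constructor
  · rintro ⟨_, ⟨g, hg, rfl⟩, rfl⟩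
    exact ⟨g, hg, by group⟩
  · rintro ⟨g, hg, rfl⟩
    exact ⟨_, ⟨g, hg, rfl⟩, by group⟩

lemma AlgGroupIso.of_conjSubgroup {P : GL (Fin n) C} {G : Subgroup (GL (Fin n) C)}
    {T : Subgroup (GL (Fin m) C)} (h : AlgGroupIso (conjSubgroup P G) T) : AlgGroupIso G T := by
  obtain ⟨f, hf, hf'⟩ := h
  refine ⟨(conjEquiv P G).trans f, fun i j => ?_, fun i j => ?_⟩
  · obtain ⟨p, hp⟩ := hf i j
    let φ : Option (Fin n × Fin n) → MvPolynomial (Option (Fin n × Fin n)) C := fun o =>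
      o.elim (MvPolynomial.X none) fun ij =>
        ∑ l, (∑ k, MvPolynomial.C ((P : Matrix (Fin n) (Fin n) C) ij.1 k) *
          MvPolynomial.X (some (k, l))) *
            MvPolynomial.C (((P⁻¹ : GL (Fin n) C) : Matrix (Fin n) (Fin n) C) l ij.2)
    refine ⟨MvPolynomial.bind₁ φ p, fun g => ?_⟩
    rw [MulEquiv.trans_apply, hp]
    simp only [MvPolynomial.eval, MvPolynomial.eval₂Hom_bind₁]
    congr 2
    funext o
    have hdet : ((conjEquiv P G g : GL (Fin n) C) : Matrix (Fin n) (Fin n) C).det =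
        ((g : GL (Fin n) C) : Matrix (Fin n) (Fin n) C).det := by
      rw [coe_conjEquiv, ← Matrix.GeneralLinearGroup.val_det_apply,
        ← Matrix.GeneralLinearGroup.val_det_apply]
      congr 1
      simp
    cases o with
    | none => simp [φ, hdet]
    | some ij =>
      simp only [φ, coe_conjEquiv, Option.elim_some, Units.val_mul, Matrix.mul_apply]
      simp
  · choose p hp using hf'
    refine ⟨∑ l, (∑ k, MvPolynomial.C (((P⁻¹ : GL (Fin n) C) : Matrix (Fin n) (Fin n) C) i k) *
      p k l) * MvPolynomial.C ((P : Matrix (Fin n) (Fin n) C) l j), fun t => ?_⟩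
    have h1 : ((((conjEquiv P G).trans f).symm t : G) : GL (Fin n) C) =
        P⁻¹ * (f.symm t : GL (Fin n) C) * P := by
      have h2 := coe_conjEquiv P G (((conjEquiv P G).trans f).symm t)
      have h3 : conjEquiv P G (((conjEquiv P G).trans f).symm t) = f.symm t := by simp
      rw [← h3, h2]
      group
    rw [h1]
    simp only [Units.val_mul, Matrix.mul_apply, map_sum, map_mul, MvPolynomial.eval_C, hp]

lemma identityComponent_conjSubgroup (P : GL (Fin n) C) (G : Subgroup (GL (Fin n) C)) :
    identityComponent (conjSubgroup P G) = conjSubgroup P (identityComponent G) := by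
  let _ := zariskiGL n C
  let e : GL (Fin n) C ≃ₜ GL (Fin n) C :=
    { toFun := fun g => P * g * P⁻¹
      invFun := fun g => P⁻¹ * g * P
      left_inv := fun g => by group
      right_inv := fun g => by group
      continuous_toFun := continuous_zariskiGL_mul_mul _ _
      continuous_invFun := continuous_zariskiGL_mul_mul _ _ }
  have := e.image_connectedComponentIn G.one_mem
  have he : e 1 = 1 := by simp [e]
  rw [he] at this
  exact SetLike.coe_injective this.symm

lemma IsAlgebraicSubgroup.conjSubgroup {G : Subgroup (GL (Fin n) C)} (hG : IsAlgebraicSubgroup G)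
    (P : GL (Fin n) C) : IsAlgebraicSubgroup (conjSubgroup P G) := by
  let _ := zariskiGL n C
  have h := hG.preimage (continuous_zariskiGL_mul_mul P⁻¹ P)
  unfold IsAlgebraicSubgroup
  convert h using 1
  ext h
  simp only [SetLike.mem_coe, mem_conjSubgroup, Set.mem_preimage]
  constructor
  · rintro ⟨g, hg, rfl⟩
    convert hg using 1
    group
  · intro hg
    exact ⟨_, hg, by group⟩

lemma detGroup_conjSubgroup (P : GL (Fin n) C) (G : Subgroup (GL (Fin n) C)) :
    detGroup (conjSubgroup P G) = detGroup G := by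
  unfold detGroup conjSubgroup
  rw [Subgroup.map_map]
  congr 1
  ext g
  simp

lemma IsIrreducibleGroup.conjSubgroup {G : Subgroup (GL (Fin n) C)} (hG : IsIrreducibleGroup G)
    (P : GL (Fin n) C) : IsIrreducibleGroup (conjSubgroup P G) := by
  intro W hW
  have hinj : ∀ Q : GL (Fin n) C, Function.Injective (Q : Matrix (Fin n) (Fin n) C).mulVecLin :=
    fun Q => Matrix.mulVec_injective_iff_isUnit.2 Q.isUnit
  have hPP : (P : Matrix (Fin n) (Fin n) C).mulVecLin ∘ₗ
      ((P⁻¹ : GL (Fin n) C) : Matrix (Fin n) (Fin n) C).mulVecLin = LinearMap.id := by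
    rw [← Matrix.mulVecLin_mul, ← Units.val_mul, mul_inv_cancel, Units.val_one,
      Matrix.mulVecLin_one]
  have hmap : (W.map ((P⁻¹ : GL (Fin n) C) : Matrix (Fin n) (Fin n) C).mulVecLin).map
      (P : Matrix (Fin n) (Fin n) C).mulVecLin = W := by
    rw [← Submodule.map_comp, hPP, Submodule.map_id]
  have h := hG (W.map ((P⁻¹ : GL (Fin n) C) : Matrix (Fin n) (Fin n) C).mulVecLin) ?_
  · rcases h with h | h
    · left
      rw [← hmap, h, Submodule.map_bot]
    · right
      rw [← hmap, h, Submodule.map_top, LinearMap.range_eq_top]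
      exact LinearMap.injective_iff_surjective.1 (hinj P)
  · intro g hg
    have h1 := Submodule.map_mono (f := ((P⁻¹ : GL (Fin n) C) :
      Matrix (Fin n) (Fin n) C).mulVecLin) (hW _ ⟨g, hg, rfl⟩)
    rw [← Submodule.map_comp, ← Matrix.mulVecLin_mul, ← Units.val_mul] at h1 ⊢
    convert h1 using 4
    simp [mul_assoc]

/-- Conjugate groups have isomorphic component groups. -/
noncomputable def componentGroupConjEquiv (P : GL (Fin n) C) (G : Subgroup (GL (Fin n) C)) :
    ComponentGroup G ≃* ComponentGroup (conjSubgroup P G) :=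
  QuotientGroup.congr _ _ (conjEquiv P G) (by
    ext ⟨h, hh⟩
    rw [Subgroup.mem_subgroupOf, identityComponent_conjSubgroup]
    constructor
    · rintro ⟨g, hg, hgh⟩
      exact ⟨g, hg, congrArg Subtype.val hgh⟩
    · rintro ⟨g, hg, rfl⟩
      exact ⟨⟨g, identityComponentSet_subset G hg⟩, hg, rfl⟩)

end Conjugation

section Imprimitive

variable {n : ℕ} {C : Type*} [Field C]

lemma mulVecLin_injective (g : GL (Fin n) C) :
    Function.Injective (g : Matrix (Fin n) (Fin n) C).mulVecLin :=
  Matrix.mulVec_injective_iff_isUnit.2 g.isUnit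

/-- An irreducible group permutes the blocks of a system of imprimitivity transitively. -/
lemma exists_map_eq_of_irreducible {G : Subgroup (GL (Fin n) C)} (hirr : IsIrreducibleGroup G)
    {r : ℕ} {V : Fin r → Submodule C (Fin n → C)} (hne : ∀ i, V i ≠ ⊥) (hind : iSupIndep V)
    (hperm : ∀ g ∈ G, ∃ σ : Equiv.Perm (Fin r), ∀ i,
      (V i).map (g : Matrix (Fin n) (Fin n) C).mulVecLin = V (σ i)) (i j : Fin r) :
    ∃ g ∈ G, (V i).map (g : Matrix (Fin n) (Fin n) C).mulVecLin = V j := by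
  by_contra hno
  let W : Submodule C (Fin n → C) := ⨆ k, ⨆ _ : ∃ g ∈ G,
    (V i).map (g : Matrix (Fin n) (Fin n) C).mulVecLin = V k, V k
  have hiW : V i ≤ W :=
    le_iSup₂_of_le i ⟨1, G.one_mem, by simp [Matrix.mulVecLin_one]⟩ le_rfl
  have hW : W = ⊤ := by
    refine (hirr W fun g hg => ?_).resolve_left fun h => hne i (le_bot_iff.1 (h ▸ hiW))
    obtain ⟨σ, hσ⟩ := hperm g hg
    simp only [W, Submodule.map_iSup]
    refine iSup₂_le fun k ⟨x, hx, hxk⟩ => ?_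
    rw [hσ k]
    refine le_iSup₂_of_le (σ k) ⟨g * x, G.mul_mem hg hx, ?_⟩ le_rfl
    rw [Units.val_mul, Matrix.mulVecLin_mul, Submodule.map_comp, hxk, hσ]
  have hle : W ≤ ⨆ k, ⨆ _ : k ≠ j, V k :=
    iSup₂_le fun k hk => le_iSup₂_of_le k (fun h => hno (h ▸ hk)) le_rfl
  have := (hind j).mono_right hle
  rw [hW, disjoint_top] at this
  exact hne j this

/-- In prime dimension, an irreducible imprimitive group is conjugate to a group of monomial
matrices. -/
lemma exists_conjSubgroup_monomial (hn : n.Prime) {G : Subgroup (GL (Fin n) C)}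
    (hirr : IsIrreducibleGroup G) (himp : IsImprimitiveGroup G) :
    ∃ P : GL (Fin n) C, ∀ h ∈ conjSubgroup P G, ∃ σ α, h = monomialGL σ α := by
  obtain ⟨r, V, hr, hne, hint, hperm⟩ := himp
  have hind := hint.submodule_iSupIndep
  have htrans := exists_map_eq_of_irreducible hirr hne hind hperm
  let i₀ : Fin r := ⟨0, by omega⟩
  have hle : ∀ i j, Module.finrank C (V i) ≤ Module.finrank C (V j) := by
    intro i j
    obtain ⟨g, -, hg⟩ := htrans j i
    rw [← hg]
    exact Submodule.finrank_map_le _ _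
  have hdim : ∀ i, Module.finrank C (V i) = Module.finrank C (V i₀) :=
    fun i => le_antisymm (hle _ _) (hle _ _)
  have hcard : n = r * Module.finrank C (V i₀) := by
    have := Module.finrank_eq_card_basis
      (hint.collectedBasis fun i => Module.finBasisOfFinrankEq C (V i) (hdim i))
    simpa using this
  have hrn : r = n := by
    refine (hn.eq_one_or_self_of_dvd r ⟨_, hcard⟩).resolve_left (by omega)
  subst hrn
  have hone : ∀ i, Module.finrank C (V i) = 1 := by
    intro i
    rw [hdim]
    exact (Nat.eq_of_mul_eq_mul_left hn.pos (by omega : r * 1 = _)).symm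
  have hb : ∀ i, ∃ v ∈ V i, v ≠ 0 := fun i => (Submodule.ne_bot_iff _).1 (hne i)
  choose b hbV hb0 using hb
  have hbspan : ∀ i, ∀ v ∈ V i, ∃ c : C, c • b i = v := by
    intro i v hv
    obtain ⟨c, hc⟩ := (finrank_eq_one_iff_of_nonzero' (⟨b i, hbV i⟩ : V i)
      (fun h => hb0 i (congrArg Subtype.val h))).1 (hone i) ⟨v, hv⟩
    exact ⟨c, congrArg Subtype.val hc⟩
  have hli : LinearIndependent C b := hind.linearIndependent _ hbV hb0
  let B : Matrix (Fin r) (Fin r) C := Matrix.of fun i j => b j i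
  have hBu : IsUnit B := by
    rw [← Matrix.linearIndependent_cols_iff_isUnit]
    exact hli
  obtain ⟨Q, hQ⟩ := hBu
  have hQ' : ∀ i j, (Q : Matrix (Fin r) (Fin r) C) i j = b j i := fun i j => by rw [hQ]; rfl
  refine ⟨Q⁻¹, ?_⟩
  rintro _ ⟨g, hg, rfl⟩
  obtain ⟨σ, hσ⟩ := hperm g hg
  have hc : ∀ j, ∃ c : Cˣ, (g : Matrix (Fin r) (Fin r) C).mulVec (b j) = (c : C) • b (σ j) := by
    intro j
    obtain ⟨c, hc⟩ := hbspan (σ j) _ (hσ j ▸ Submodule.mem_map_of_mem (hbV j))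
    refine ⟨Units.mk0 c ?_, hc.symm⟩
    rintro rfl
    rw [zero_smul] at hc
    exact hb0 j (mulVecLin_injective g (by rw [← hc, map_zero]))
  choose c hc using hc
  refine ⟨σ⁻¹, fun i => c (σ⁻¹ i), ?_⟩
  change Q⁻¹ * g * Q⁻¹⁻¹ = _
  rw [inv_inv, mul_assoc, inv_mul_eq_iff_eq_mul]
  ext i j
  have h1 := congrFun (hc j) i
  have h2 : ((Q * monomialGL σ⁻¹ fun i => c (σ⁻¹ i) : GL (Fin r) C) :
      Matrix (Fin r) (Fin r) C) i j = b (σ j) i * c j := by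
    rw [Units.val_mul, Matrix.mul_apply, Finset.sum_eq_single (σ j) (fun k _ hk => ?_) (by simp)]
    · simp [monomialGL_apply, hQ']
    · have : j ≠ σ⁻¹ k := fun h => hk (by rw [h]; simp)
      rw [monomialGL_apply, if_neg this, mul_zero]
  rw [h2, mul_comm, Units.val_mul, Matrix.mul_apply]
  simp only [hQ']
  exact h1

/-- A group generated by a monomial matrix `M` and diagonal matrices can only be irreducible when
the permutation of `M` is transitive. -/
lemma sameCycle_of_irreducible {H : Subgroup (GL (Fin n) C)}
    (hirr : IsIrreducibleGroup H) {σ : Equiv.Perm (Fin n)} {α : Fin n → Cˣ}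
    (hgen : ∀ h ∈ H, ∃ j : ℤ, ∃ d ∈ torus n C, h = monomialGL σ α ^ j * d) :
    ∀ a b, σ.SameCycle a b := by
  intro a b
  by_contra hab
  let W : Submodule C (Fin n → C) :=
    { carrier := {v | ∀ i, ¬ σ.SameCycle a i → v i = 0}
      zero_mem' := fun i _ => rfl
      add_mem' := fun {v w} hv hw i hi => by simp [hv i hi, hw i hi]
      smul_mem' := fun c v hv i hi => by simp [hv i hi] }
  have hstable : ∀ g ∈ H, W.map (g : Matrix (Fin n) (Fin n) C).mulVecLin ≤ W := by
    rintro g hg _ ⟨v, hv, rfl⟩ i hi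
    obtain ⟨j, d, hd, rfl⟩ := hgen g hg
    obtain ⟨β, rfl⟩ := mem_torus.1 hd
    obtain ⟨γ, hγ⟩ := monomialGL_zpow σ α j
    have hi' : ¬ σ.SameCycle a ((σ ^ j) i) := fun h =>
      hi (Equiv.Perm.sameCycle_zpow_right.1 h)
    rw [hγ, monomialGL_mul, one_mul, Matrix.mulVecLin_apply, Matrix.mulVec, dotProduct,
      Finset.sum_eq_single ((σ ^ j) i) (fun k _ hk => by simp [monomialGL_apply, hk]) (by simp),
      hv _ hi', mul_zero]
  rcases hirr W hstable with h | h
  · have : (Pi.single a 1 : Fin n → C) ∈ W := fun i hi =>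
      Pi.single_eq_of_ne (by rintro rfl; exact hi (Equiv.Perm.SameCycle.refl _ _)) _
    rw [h, Submodule.mem_bot] at this
    simpa using congrFun this a
  · have : (Pi.single b 1 : Fin n → C) ∈ W := h ▸ Submodule.mem_top
    simpa using this b hab

/-- An element of `H` whose class generates `H / H⁰`. -/
lemma exists_generator (H : Subgroup (GL (Fin n) C)) [IsCyclic (ComponentGroup H)] :
    ∃ M ∈ H, ∀ h ∈ H, ∃ j : ℤ, ∃ d ∈ identityComponent H, h = M ^ j * d := by
  obtain ⟨q, hq⟩ := IsCyclic.exists_generator (α := ComponentGroup H)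
  obtain ⟨⟨M, hM⟩, rfl⟩ := QuotientGroup.mk_surjective q
  exact ⟨M, hM, (zpowers_mk_eq_top_iff hM).1 ((Subgroup.eq_top_iff' _).2 hq)⟩

/-- Every transitive permutation is conjugate to the standard cycle. -/
lemma exists_conj_eq_finRotate (hn : 2 ≤ n) {σ : Equiv.Perm (Fin n)}
    (hσ : ∀ a b, σ.SameCycle a b) : ∃ τ : Equiv.Perm (Fin n), τ * σ * τ⁻¹ = finRotate n := by
  have hne : ∀ i, σ i ≠ i := by
    intro i hi
    have : Nontrivial (Fin n) := Fin.nontrivial_iff_two_le.2 hn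
    obtain ⟨j, hj⟩ := exists_ne i
    obtain ⟨k, hk⟩ := hσ i j
    rw [Equiv.Perm.zpow_apply_eq_self_of_apply_eq_self hi] at hk
    exact hj hk.symm
  have hcycle : σ.IsCycle := ⟨⟨0, by omega⟩, hne _, fun j _ => hσ _ j⟩
  have hsupp : σ.support = Finset.univ := by
    ext i
    simp [hne i]
  have : IsConj σ (finRotate n) := by
    rw [hcycle.isConj_iff (isCycle_finRotate_of_le hn), hsupp, support_finRotate_of_le hn]
  exact isConj_iff.1 this

end Imprimitive

section MainTheorem

variable {n : ℕ} {C : Type*} [Field C]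

/-- An irreducible monomial group with finite cyclic component group is conjugate to one whose
component group is generated by a standard cyclic monomial matrix. -/
lemma exists_conjSubgroup_finRotate (hn : 2 ≤ n) {H : Subgroup (GL (Fin n) C)}
    (hirr : IsIrreducibleGroup H) [Finite (ComponentGroup H)] [IsCyclic (ComponentGroup H)]
    (hmon : ∀ h ∈ H, ∃ σ α, h = monomialGL σ α) :
    ∃ Q : GL (Fin n) C, identityComponent (conjSubgroup Q H) ≤ torus n C ∧
      ∃ α, monomialGL (finRotate n) α ∈ conjSubgroup Q H ∧
        ∀ h ∈ conjSubgroup Q H, ∃ j : ℤ, ∃ d ∈ identityComponent (conjSubgroup Q H),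
          h = monomialGL (finRotate n) α ^ j * d := by
  have hle := identityComponent_le_torus_of_monomial hmon
  obtain ⟨M, hM, hgen⟩ := exists_generator H
  obtain ⟨σ, α, rfl⟩ := hmon M hM
  obtain ⟨τ, hτ⟩ := exists_conj_eq_finRotate hn (sameCycle_of_irreducible hirr (σ := σ) (α := α)
    fun h hh => by
      obtain ⟨j, d, hd, rfl⟩ := hgen h hh
      exact ⟨j, d, hle hd, rfl⟩)
  let Q : GL (Fin n) C := monomialGL τ⁻¹ 1
  have hQM : Q * monomialGL σ α * Q⁻¹ =
      monomialGL (finRotate n) (fun i => α (τ⁻¹ i)) := by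
    simp only [Q, monomialGL_inv, monomialGL_mul, ← hτ]
    rw [monomialGL_inj]
    exact ⟨by group, by funext i; simp⟩
  refine ⟨Q, ?_, _, ⟨_, hM, hQM⟩, ?_⟩
  · rw [identityComponent_conjSubgroup]
    rintro _ ⟨g, hg, rfl⟩
    obtain ⟨β, rfl⟩ := mem_torus.1 (hle hg)
    exact mem_torus.2 ⟨_, monomialGL_conj _ _ _⟩
  · rintro _ ⟨g, hg, rfl⟩
    obtain ⟨j, d, hd, rfl⟩ := hgen g hg
    rw [identityComponent_conjSubgroup]
    refine ⟨j, Q * d * Q⁻¹, ⟨d, hd, rfl⟩, ?_⟩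
    rw [← hQM, conj_zpow]
    change Q * (_ * d) * Q⁻¹ = _
    group

lemma commute_identityComponent {G : Subgroup (GL (Fin n) C)} [Finite (ComponentGroup G)]
    {P : GL (Fin n) C} (hmon : ∀ h ∈ conjSubgroup P G, ∃ σ α, h = monomialGL σ α) :
    ∀ g ∈ identityComponent G, ∀ h ∈ identityComponent G, g * h = h * g := by
  have : Finite (ComponentGroup (conjSubgroup P G)) :=
    Finite.of_equiv _ (componentGroupConjEquiv P G).toEquiv
  have hle := identityComponent_le_torus_of_monomial hmon
  rw [identityComponent_conjSubgroup] at hle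
  intro g hg h hh
  obtain ⟨β, hβ⟩ := mem_torus.1 (hle ⟨g, hg, rfl⟩)
  obtain ⟨γ, hγ⟩ := mem_torus.1 (hle ⟨h, hh, rfl⟩)
  apply (MulAut.conj P).injective
  have hβ : MulAut.conj P g = monomialGL 1 β := hβ
  have hγ : MulAut.conj P h = monomialGL 1 γ := hγ
  rw [map_mul, map_mul, hβ, hγ, ← diagHom_apply, ← diagHom_apply, ← map_mul, ← map_mul, mul_comm]

end MainTheorem

theorem theorem1 {C : Type*} [Field C] [IsAlgClosed C] [CharZero C]
    (ζ : ℕ → Cˣ) (hζ : ∀ m : ℕ, 0 < m → IsPrimitiveRoot (ζ m) m)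
    (n : ℕ) (hn : n.Prime) (G : Subgroup (GL (Fin n) C))
    (hG : IsAlgebraicSubgroup G) (hirr : IsIrreducibleGroup G) (himp : IsImprimitiveGroup G)
    (hfin : Finite (ComponentGroup G)) (hcyc : IsCyclic (ComponentGroup G)) :
    -- up to conjugation, `G` is of the first or of the second type
    (∃ P : GL (Fin n) C, IsFullMonomial (conjSubgroup P G) ∨
      ∃ (s : ℕ) (k : ℤ) (α : Fin n → Cˣ), IsTwistedMonomial ζ (conjSubgroup P G) s k α) ∧
    -- consequences in the first case
    (∀ P : GL (Fin n) C, IsFullMonomial (conjSubgroup P G) →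
      AlgGroupIso (identityComponent (conjSubgroup P G)) (torus n C) ∧
      Nonempty (ComponentGroup (conjSubgroup P G) ≃* Multiplicative (ZMod n)) ∧
      detGroup (conjSubgroup P G) = ⊤) ∧
    -- consequences in the second case
    (∀ (P : GL (Fin n) C) (s : ℕ) (k : ℤ) (α : Fin n → Cˣ),
      IsTwistedMonomial ζ (conjSubgroup P G) s k α →
      (identityComponent (conjSubgroup P G) : Set (GL (Fin n) C)) = diagProdPow n C 1 ∧
      AlgGroupIso (identityComponent (conjSubgroup P G)) (torus (n - 1) C) ∧
      Nonempty (ComponentGroup (conjSubgroup P G) ≃* Multiplicative (ZMod (n * s))) ∧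
      (n = 2 → Nonempty (detGroup (conjSubgroup P G) ≃*
        Multiplicative (ZMod (2 * s / Int.gcd (k + s) 2)))) ∧
      (2 < n → Nonempty (detGroup (conjSubgroup P G) ≃*
        Multiplicative (ZMod (n * s / Int.gcd k n))))) ∧
    -- the determinant group distinguishes the cases and determines `s`
    (detGroup G = ⊤ ↔ ∃ P : GL (Fin n) C, IsFullMonomial (conjSubgroup P G)) ∧
    (∀ ν : ℕ, 0 < ν → Nonempty (detGroup G ≃* Multiplicative (ZMod ν)) →
      ∀ (P : GL (Fin n) C) (s : ℕ) (k : ℤ) (α : Fin n → Cˣ),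
        IsTwistedMonomial ζ (conjSubgroup P G) s k α → s = if n ∣ ν then ν / n else ν) ∧
    -- the resulting description of `G` in terms of the determinant group
    (detGroup G = ⊤ → AlgGroupIso (identityComponent G) (torus n C) ∧
      Nonempty (ComponentGroup G ≃* Multiplicative (ZMod n))) ∧
    (∀ ν : ℕ, 0 < ν → Nonempty (detGroup G ≃* Multiplicative (ZMod ν)) →
      AlgGroupIso (identityComponent G) (torus (n - 1) C) ∧
      Nonempty (ComponentGroup G ≃*
        Multiplicative (ZMod (n * if n ∣ ν then ν / n else ν)))) := by
  have h2 := hn.two_le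
  obtain ⟨P₀, hmon⟩ := exists_conjSubgroup_monomial hn hirr himp
  have hcomm := commute_identityComponent hmon
  have hfinite : ∀ P, Finite (ComponentGroup (conjSubgroup P G)) := fun P =>
    Finite.of_equiv _ (componentGroupConjEquiv P G).toEquiv
  have hcomm' : ∀ P, ∀ g ∈ identityComponent (conjSubgroup P G),
      ∀ h ∈ identityComponent (conjSubgroup P G), g * h = h * g := by
    intro P
    rw [identityComponent_conjSubgroup]
    rintro _ ⟨g, hg, rfl⟩ _ ⟨h, hh, rfl⟩
    rw [← map_mul, ← map_mul, hcomm g hg h hh]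
  have hA : ∃ P : GL (Fin n) C, IsFullMonomial (conjSubgroup P G) ∨
      ∃ (s : ℕ) (k : ℤ) (α : Fin n → Cˣ), IsTwistedMonomial ζ (conjSubgroup P G) s k α := by
    have hcyc' : IsCyclic (ComponentGroup (conjSubgroup P₀ G)) :=
      (componentGroupConjEquiv P₀ G).isCyclic.1 hcyc
    have := hfinite P₀
    obtain ⟨Q, hle, α, hM, hgen⟩ := exists_conjSubgroup_finRotate h2 (hirr.conjSubgroup P₀) hmon
    rw [conjSubgroup_conjSubgroup] at hle hM hgen
    have := hfinite (Q * P₀)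
    have hnz : NeZero n := ⟨hn.ne_zero⟩
    obtain ⟨s, hs⟩ := exists_diagonal_part_eq hn (hG.conjSubgroup (Q * P₀))
      (hirr.conjSubgroup _) hle hM hgen
    have h0 := identityComponent_eq_of_inf_torus_eq hle hs
    refine ⟨Q * P₀, ?_⟩
    obtain rfl | hpos := Nat.eq_zero_or_pos s
    · left
      rw [diagProdPowSubgroup_zero, inf_eq_right] at hs
      refine isFullMonomial_of_torus_le h2 hs hM fun h hh => ?_
      obtain ⟨j, d, hd, rfl⟩ := hgen h hh
      exact ⟨j, d, hle hd, rfl⟩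
    · right
      rw [min_eq_right hpos] at h0
      obtain ⟨k, hk⟩ := exists_isTwistedMonomial h2 hζ hpos hs h0 hM hgen
      exact ⟨s, k, α, hk⟩
  have hB : ∀ P : GL (Fin n) C, IsFullMonomial (conjSubgroup P G) →
      AlgGroupIso (identityComponent (conjSubgroup P G)) (torus n C) ∧
      Nonempty (ComponentGroup (conjSubgroup P G) ≃* Multiplicative (ZMod n)) ∧
      detGroup (conjSubgroup P G) = ⊤ := by
    intro P hP
    have := hfinite P
    refine ⟨?_, hP.nonempty_componentGroup_mulEquiv h2, hP.detGroup_eq_top h2⟩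
    rw [hP.identityComponent_eq h2]
    exact AlgGroupIso.refl _
  have h0 : ∀ (P : GL (Fin n) C) (s : ℕ) (k : ℤ) (α : Fin n → Cˣ),
      IsTwistedMonomial ζ (conjSubgroup P G) s k α →
      identityComponent (conjSubgroup P G) = diagProdPowSubgroup n C 1 := by
    intro P s k α h
    have := hfinite P
    exact h.identityComponent_eq h2 (hcomm' P)
  have hiso : ∀ (P : GL (Fin n) C) (s : ℕ) (k : ℤ) (α : Fin n → Cˣ),
      IsTwistedMonomial ζ (conjSubgroup P G) s k α →
      AlgGroupIso (identityComponent (conjSubgroup P G)) (torus (n - 1) C) := by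
    intro P s k α h
    rw [h0 P s k α h]
    obtain ⟨m, rfl⟩ := Nat.exists_eq_add_of_lt hn.pos
    simpa using algGroupIso_diagProdPowSubgroup_one (C := C) (0 + m)
  have hcard : ∀ {A : Type _} [Group A] {a b : ℕ}, Nonempty (A ≃* Multiplicative (ZMod a)) →
      Nonempty (A ≃* Multiplicative (ZMod b)) → a = b := by
    rintro A _ a b ⟨e⟩ ⟨f⟩
    have := Nat.card_congr (e.symm.trans f).toEquiv
    simpa [Nat.card_congr Multiplicative.toAdd, Nat.card_zmod] using this
  have hD : ∀ ν : ℕ, 0 < ν → Nonempty (detGroup G ≃* Multiplicative (ZMod ν)) →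
      ∀ (P : GL (Fin n) C) (s : ℕ) (k : ℤ) (α : Fin n → Cˣ),
        IsTwistedMonomial ζ (conjSubgroup P G) s k α → s = if n ∣ ν then ν / n else ν := by
    intro ν hν hdet P s k α h
    have h1 := h.nonempty_detGroup_mulEquiv hn hζ (h0 P s k α h)
    rw [detGroup_conjSubgroup] at h1
    exact eq_ite_dvd_of_order_eq hn h.1 h.2.2.2.1 (hcard hdet h1)
  have hinf : ∀ ν : ℕ, 0 < ν → Nonempty (detGroup G ≃* Multiplicative (ZMod ν)) →
      detGroup G ≠ ⊤ := by
    rintro ν hν ⟨e⟩ htop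
    have : NeZero ν := ⟨hν.ne'⟩
    have hfin : Finite (detGroup G) := Finite.of_equiv (ZMod ν) e.symm.toEquiv
    rw [htop] at hfin
    have : Finite Cˣ := Finite.of_equiv _ Subgroup.topEquiv.toEquiv
    have : Infinite Cˣ := Infinite.of_injective
      (fun m : ℕ => Units.mk0 ((m : C) + 1) (Nat.cast_add_one_ne_zero m)) fun a b hab => by
        simpa using congrArg Units.val hab
    exact not_finite Cˣ
  have hfindet : ∀ (P : GL (Fin n) C) (s : ℕ) (k : ℤ) (α : Fin n → Cˣ),
      IsTwistedMonomial ζ (conjSubgroup P G) s k α → detGroup G ≠ ⊤ := by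
    intro P s k α h
    have h1 := h.nonempty_detGroup_mulEquiv hn hζ (h0 P s k α h)
    rw [detGroup_conjSubgroup] at h1
    refine hinf _ ?_ h1
    have hs := h.1
    split_ifs
    · exact Nat.div_pos (Nat.le_of_dvd (by positivity)
        (dvd_mul_of_dvd_left (by exact_mod_cast Int.gcd_dvd_right (k + s) 2) _))
        (Int.gcd_pos_of_ne_zero_right _ two_ne_zero)
    · exact Nat.div_pos (Nat.le_of_dvd (Nat.mul_pos hn.pos hs)
        (dvd_mul_of_dvd_left (by exact_mod_cast Int.gcd_dvd_right k n) _))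
        (Int.gcd_pos_of_ne_zero_right _ (by exact_mod_cast hn.ne_zero))
  have hfull : detGroup G = ⊤ ↔ ∃ P : GL (Fin n) C, IsFullMonomial (conjSubgroup P G) := by
    constructor
    · intro htop
      obtain ⟨P, hP | ⟨s, k, α, hP⟩⟩ := hA
      · exact ⟨P, hP⟩
      · exact absurd htop (hfindet P s k α hP)
    · rintro ⟨P, hP⟩
      rw [← detGroup_conjSubgroup P]
      exact (hB P hP).2.2
  refine ⟨hA, hB, ?_, hfull, hD, ?_, ?_⟩
  · intro P s k α h
    have h1 := h.nonempty_detGroup_mulEquiv hn hζ (h0 P s k α h)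
    refine ⟨by rw [h0 P s k α h, coe_diagProdPowSubgroup], hiso P s k α h,
      h.nonempty_componentGroup_mulEquiv h2 hζ (h0 P s k α h), fun hn2 => ?_, fun hn2 => ?_⟩
    · rwa [if_pos hn2] at h1
    · rwa [if_neg hn2.ne'] at h1
  · intro htop
    obtain ⟨P, hP⟩ := hfull.1 htop
    obtain ⟨h3, ⟨e⟩, -⟩ := hB P hP
    rw [identityComponent_conjSubgroup] at h3
    exact ⟨h3.of_conjSubgroup, ⟨(componentGroupConjEquiv P G).trans e⟩⟩
  · intro ν hν hdet
    obtain ⟨P, hP | ⟨s, k, α, hP⟩⟩ := hA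
    · exact absurd (hfull.2 ⟨P, hP⟩) (hinf ν hν hdet)
    · have h3 := hiso P s k α hP
      rw [identityComponent_conjSubgroup] at h3
      obtain ⟨e⟩ := hP.nonempty_componentGroup_mulEquiv h2 hζ (h0 P s k α hP)
      rw [← hD ν hν hdet P s k α hP]
      exact ⟨h3.of_conjSubgroup, ⟨(componentGroupConjEquiv P G).trans e⟩⟩
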